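/- A locally $C^*$-algebra is a (not necessarily unital) complete Hausdorff topological complex $*$-algebra whose topology is defined by some upward directed family of $C^*$-seminorms, that is, of submultiplicative seminorms $p$ with $p(a^*a)=p(a)^2$ for all $a$. A continuous positive functional on such an algebra $A$ is a continuous linear map $f:A\to\mathbb{C}$ with $f(a^*a)\ge 0$ for all $a\in A$; for two such functionals, $g\le f$ means that $f-g$ is positive. It is pure if $f\neq 0$ and every continuous positive functional $g$ on $A$ with $g\le f$ is of the form $g=\alpha f$ for some $\alpha\in[0,1]$. A locally $C^*$-algebra $A$ is scattered if every continuous positive functional $f$ on $A$ is a countable (finite, possibly empty, or infinite) sum $f=\sum_n f_n$ of pure functionals $f_n$ on $A$, in the sense of pointwise convergence. Let $A$ be a scattered locally $C^*$-algebra and let $B\subseteq A$ be a closed $*$-subalgebra (not assumed to contain a unit). Then $B$, with the topology induced from $A$, is a locally $C^*$-algebra, and it is scattered. -/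

import Mathlib

open scoped ComplexOrder

/-- A C⋆-seminorm on a complex ⋆-algebra. -/
structure IsCStarSeminorm {A : Type*} [NonUnitalRing A] [StarRing A] [Module ℂ A]
    (p : Seminorm ℂ A) : Prop where
  mul_le : ∀ a b : A, p (a * b) ≤ p a * p b
  star_mul_self : ∀ a : A, p (star a * a) = p a ^ 2

/-- A locally C⋆-algebra: a complete Hausdorff topological ⋆-algebra whose topology is defined by
some (nonempty) upward directed family of C⋆-seminorms. `IsUniformAddGroup` says that the uniform
structure, with respect to which completeness is meant, is that of the additive topological
group. -/
structure IsLocallyCStarAlgebra (A : Type*) [NonUnitalRing A] [StarRing A] [Module ℂ A]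
    [IsScalarTower ℂ A A] [SMulCommClass ℂ A A] [StarModule ℂ A] [UniformSpace A] : Prop where
  isUniformAddGroup : IsUniformAddGroup A
  continuousSMul : ContinuousSMul ℂ A
  continuousMul : ContinuousMul A
  continuousStar : ContinuousStar A
  t2Space : T2Space A
  completeSpace : CompleteSpace A
  exists_seminorms : ∃ Γ : Set (Seminorm ℂ A), Γ.Nonempty ∧ DirectedOn (· ≤ ·) Γ ∧
    (∀ p ∈ Γ, IsCStarSeminorm p) ∧ WithSeminorms (fun p : Γ => (p : Seminorm ℂ A))

section Functionals

variable {A : Type*} [NonUnitalRing A] [StarRing A] [Module ℂ A] [TopologicalSpace A]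

/-- A continuous linear functional `f` is positive if `f (a⋆ a)` is a nonnegative real for
all `a`. -/
def IsPositiveFunctional (f : A →L[ℂ] ℂ) : Prop :=
  ∀ a : A, 0 ≤ f (star a * a)

/-- A pure functional: a nonzero continuous positive functional `f` such that every continuous
positive functional `g ≤ f` (meaning that `f - g` is positive) is `α f` for some `α ∈ [0, 1]`. -/
structure IsPureFunctional (f : A →L[ℂ] ℂ) : Prop where
  positive : IsPositiveFunctional f
  ne_zero : f ≠ 0
  eq_smul_of_le : ∀ g : A →L[ℂ] ℂ, IsPositiveFunctional g → IsPositiveFunctional (f - g) →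
    ∃ α : ℝ, α ∈ Set.Icc (0 : ℝ) 1 ∧ g = (α : ℂ) • f

end Functionals

/-- Every continuous positive functional is a countable (possibly finite or empty) sum of pure
functionals, converging pointwise. -/
def IsScattered (A : Type*) [NonUnitalRing A] [StarRing A] [Module ℂ A]
    [TopologicalSpace A] : Prop :=
  ∀ f : A →L[ℂ] ℂ, IsPositiveFunctional f →
    ∃ (ι : Type) (_ : Countable ι) (F : ι → A →L[ℂ] ℂ),
      (∀ i, IsPureFunctional (F i)) ∧ ∀ a : A, HasSum (fun i => F i a) (f a)

/-! ### The C⋆-algebra completion of a ⋆-algebra with respect to a C⋆-seminorm -/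

section Completion

open UniformSpace UniformSpace.Completion

variable {A : Type*} [NonUnitalRing A] [StarRing A] [Module ℂ A]

/-! For a C⋆-algebra three properties are equivalent: being scattered; every nonzero positive
functional dominates a pure one (`DominatesPure`); no self-adjoint element has a positive interval
in its quasispectrum (`NoSpectralInterval`). The third visibly passes to subalgebras, because an
injective ⋆-homomorphism does not enlarge spectra (`NoSpectralInterval.of_injective`).

From domination to scatteredness: exhaust `f` by a maximal set of pure functionals with finite sums
below `f`; the set is countable, and a nonzero remainder would dominate a further pure functional.

From domination to absence of intervals: if `[s, t]` lies in the spectrum of `a`, a limit of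
averages of point states is a functional `f` that restricts to normalized Lebesgue measure on
functions of `a` and is centralized by them. Let `h ≤ f` be pure, with `S` the contraction from the
GNS space of `f` to that of `h`. A partition of unity in functions of `a` acts by right
multiplications `R i` in the commutant, so each `S (R i) (R i)⋆ S⋆` is a scalar by purity, and these
scalars have bounded sum. Since each piece has small `f`-mass, `h` is arbitrarily small on an
element acting as a unit for `f`; hence `h = 0`, which is absurd.

From absence of intervals to domination: the image of a GNS representation inherits the property and
contains a minimal projection, for otherwise a dyadic tree of projections would build an element
with spectrum containing `(0, 1]`. A vector in the range of a minimal projection generates an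
irreducible summand, and compressing `f` to it gives a pure functional below `f`.

In the locally C⋆ case, a continuous functional on `B` is bounded by one seminorm `p`, so it factors
through the closure `E` of the image of `B` in the completion of `A` for `p`. Scatteredness of `A`
gives domination for that completion, the equivalences carry it to `E`, and pure functionals on `E`
pull back to pure ones on `B`. -/

lemma IsCStarSeminorm.map_star {p : Seminorm ℂ A} (hp : IsCStarSeminorm p) (a : A) :
    p (star a) = p a := by
  have key : ∀ b : A, p b ≤ p (star b) := by
    intro b
    rcases eq_or_lt_of_le (apply_nonneg p b) with h | h
    · rw [← h]; exact apply_nonneg p _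
    · have h1 := hp.mul_le (star b) b
      rw [hp.star_mul_self, sq] at h1
      exact le_of_mul_le_mul_right h1 h
  exact le_antisymm (by simpa using key (star a)) (key a)

/-- A copy of `A`, to be topologized by the seminorm `p`. -/
@[nolint unusedArguments]
def WithSeminorm (_ : Seminorm ℂ A) : Type _ := A

namespace WithSeminorm

variable (p : Seminorm ℂ A)

instance : NonUnitalRing (WithSeminorm p) := inferInstanceAs (NonUnitalRing A)
instance : StarRing (WithSeminorm p) := inferInstanceAs (StarRing A)
instance : Module ℂ (WithSeminorm p) := inferInstanceAs (Module ℂ A)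
instance [IsScalarTower ℂ A A] : IsScalarTower ℂ (WithSeminorm p) (WithSeminorm p) :=
  inferInstanceAs (IsScalarTower ℂ A A)
instance [SMulCommClass ℂ A A] : SMulCommClass ℂ (WithSeminorm p) (WithSeminorm p) :=
  inferInstanceAs (SMulCommClass ℂ A A)
instance [StarModule ℂ A] : StarModule ℂ (WithSeminorm p) :=
  inferInstanceAs (StarModule ℂ A)

noncomputable instance : SeminormedAddCommGroup (WithSeminorm p) :=
  fast_instance% AddGroupSeminorm.toSeminormedAddCommGroup p.toAddGroupSeminorm

noncomputable instance : NormedSpace ℂ (WithSeminorm p) where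
  norm_smul_le c a := (map_smul_eq_mul p c a).le

variable [hp : Fact (IsCStarSeminorm p)]

noncomputable instance : NonUnitalSeminormedRing (WithSeminorm p) :=
  { (inferInstance : SeminormedAddCommGroup (WithSeminorm p)),
    (inferInstance : NonUnitalRing (WithSeminorm p)) with
    norm_mul_le := hp.out.mul_le }

instance : NormedStarGroup (WithSeminorm p) where
  norm_star_le a := (hp.out.map_star a).le

/-- The C⋆-algebra completion of a ⋆-algebra with respect to a C⋆-seminorm. -/
abbrev Compl : Type _ := Completion (WithSeminorm p)

/-- Multiplication need not be uniformly continuous, so it is extended along the dense inducing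
product map; bilinearity makes the extension continuous. -/
noncomputable instance : Mul (Compl p) :=
  ⟨Function.curry <| (isDenseInducing_coe.prodMap isDenseInducing_coe).extend
    ((↑) ∘ Function.uncurry (· * ·))⟩

lemma coe_mul (a b : WithSeminorm p) : ((a * b : WithSeminorm p) : Compl p) = a * b :=
  ((isDenseInducing_coe.prodMap isDenseInducing_coe).extend_eq
      ((continuous_coe _).comp continuous_mul) (a, b)).symm

instance : ContinuousMul (Compl p) where
  continuous_mul := by
    let m := (AddMonoidHom.mul : WithSeminorm p →+ WithSeminorm p →+ WithSeminorm p).compr₂ toCompl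
    have : Continuous fun x : WithSeminorm p × WithSeminorm p => m x.1 x.2 :=
      (continuous_coe _).comp continuous_mul
    have di : IsDenseInducing (toCompl : WithSeminorm p → Compl p) := isDenseInducing_coe
    exact (di.extend_Z_bilin di this :)

noncomputable instance : NonUnitalNormedRing (Compl p) :=
  { (inferInstance : NormedAddCommGroup (Compl p)), (inferInstance : Mul (Compl p)) with
    zero_mul a := by
      induction a using Completion.induction_on with
      | hp => exact isClosed_eq (by fun_prop) continuous_const
      | ih a => rw [← Completion.coe_zero, ← coe_mul, zero_mul]
    mul_zero a := by
      induction a using Completion.induction_on with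
      | hp => exact isClosed_eq (by fun_prop) continuous_const
      | ih a => rw [← Completion.coe_zero, ← coe_mul, mul_zero]
    mul_assoc a b c := by
      induction a, b, c using Completion.induction_on₃ with
      | hp => exact isClosed_eq (by fun_prop) (by fun_prop)
      | ih a b c => simp only [← coe_mul, mul_assoc]
    left_distrib a b c := by
      induction a, b, c using Completion.induction_on₃ with
      | hp => exact isClosed_eq (by fun_prop) (by fun_prop)
      | ih a b c => simp only [← coe_mul, ← Completion.coe_add, mul_add]
    right_distrib a b c := by
      induction a, b, c using Completion.induction_on₃ with
      | hp => exact isClosed_eq (by fun_prop) (by fun_prop)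
      | ih a b c => simp only [← coe_mul, ← Completion.coe_add, add_mul]
    norm_mul_le a b := by
      induction a, b using Completion.induction_on₂ with
      | hp => exact isClosed_le (by fun_prop) (by fun_prop)
      | ih a b => simpa only [← coe_mul, norm_coe] using norm_mul_le a b }

noncomputable instance : Star (Compl p) := ⟨Completion.map star⟩

lemma uniformContinuous_star : UniformContinuous (star : WithSeminorm p → WithSeminorm p) :=
  star_isometry.uniformContinuous

lemma coe_star (a : WithSeminorm p) : ((star a : WithSeminorm p) : Compl p) = star (a : Compl p) :=
  (Completion.map_coe (uniformContinuous_star p) a).symm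

instance : ContinuousStar (Compl p) := ⟨Completion.continuous_map⟩

noncomputable instance : StarRing (Compl p) where
  star_involutive a := by
    induction a using Completion.induction_on with
    | hp => exact isClosed_eq (by fun_prop) continuous_id
    | ih a => simp only [← coe_star, star_star]
  star_mul a b := by
    induction a, b using Completion.induction_on₂ with
    | hp => exact isClosed_eq (by fun_prop) (by fun_prop)
    | ih a b => simp only [← coe_star, ← coe_mul, star_mul]
  star_add a b := by
    induction a, b using Completion.induction_on₂ with
    | hp => exact isClosed_eq (by fun_prop) (by fun_prop)
    | ih a b => simp only [← coe_star, ← Completion.coe_add, star_add]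

variable [IsScalarTower ℂ A A] [SMulCommClass ℂ A A] [StarModule ℂ A]

omit [SMulCommClass ℂ A A] [StarModule ℂ A] in
lemma smul_mul_assoc' (c : ℂ) (a b : Compl p) : c • a * b = c • (a * b) := by
  induction a, b using Completion.induction_on₂ with
  | hp =>
    exact isClosed_eq (((continuous_const_smul c).comp continuous_fst).mul continuous_snd)
      ((continuous_const_smul c).comp (continuous_fst.mul continuous_snd))
  | ih a b => rw [← Completion.coe_smul, ← coe_mul, ← coe_mul, ← Completion.coe_smul, smul_mul_assoc]

omit [IsScalarTower ℂ A A] [StarModule ℂ A] in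
lemma mul_smul_comm' (c : ℂ) (a b : Compl p) : a * c • b = c • (a * b) := by
  induction a, b using Completion.induction_on₂ with
  | hp =>
    exact isClosed_eq (continuous_fst.mul ((continuous_const_smul c).comp continuous_snd))
      ((continuous_const_smul c).comp (continuous_fst.mul continuous_snd))
  | ih a b => rw [← Completion.coe_smul, ← coe_mul, ← coe_mul, ← Completion.coe_smul, mul_smul_comm]

omit [IsScalarTower ℂ A A] [SMulCommClass ℂ A A] in
lemma star_smul' (c : ℂ) (a : Compl p) : star (c • a) = star c • star a := by
  induction a using Completion.induction_on with
  | hp =>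
    exact isClosed_eq (continuous_star.comp (continuous_const_smul c))
      ((continuous_const_smul (star c)).comp continuous_star)
  | ih a => rw [← Completion.coe_smul, ← coe_star, ← coe_star, ← Completion.coe_smul, star_smul]

omit [IsScalarTower ℂ A A] [SMulCommClass ℂ A A] [StarModule ℂ A] in
lemma norm_mul_self_le' (a : Compl p) : ‖a‖ * ‖a‖ ≤ ‖star a * a‖ := by
  induction a using Completion.induction_on with
  | hp =>
    exact isClosed_le (continuous_norm.mul continuous_norm)
      (continuous_norm.comp (continuous_star.mul continuous_id))
  | ih a =>
    rw [← coe_star, ← coe_mul, norm_coe, norm_coe, ← sq]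
    exact (hp.out.star_mul_self a).ge

noncomputable instance : NonUnitalCStarAlgebra (Compl p) where
  norm_mul_self_le := norm_mul_self_le' p
  norm_smul_le := norm_smul_le
  smul_assoc := smul_mul_assoc' p
  smul_comm c a b := (mul_smul_comm' p c a b).symm
  star_smul := star_smul' p

/-- The identity map to `WithSeminorm p`. -/
def of (a : A) : WithSeminorm p := a

/-- The canonical map of a ⋆-algebra to its completion with respect to a C⋆-seminorm. -/
noncomputable def toCompletion : A →⋆ₙₐ[ℂ] Compl p where
  toFun a := (of p a : Compl p)
  map_smul' c a := Completion.coe_smul c (of p a)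
  map_zero' := Completion.coe_zero
  map_add' a b := Completion.coe_add (of p a) (of p b)
  map_mul' a b := coe_mul p (of p a) (of p b)
  map_star' a := coe_star p (of p a)

omit [IsScalarTower ℂ A A] [SMulCommClass ℂ A A] [StarModule ℂ A] in
lemma norm_toCompletion (a : A) : ‖toCompletion p a‖ = p a :=
  norm_coe (of p a)

omit [IsScalarTower ℂ A A] [SMulCommClass ℂ A A] [StarModule ℂ A] in
lemma denseRange_toCompletion : DenseRange (toCompletion p) :=
  Completion.denseRange_coe (α := WithSeminorm p)

end WithSeminorm

end Completion

/-! ### Positive functionals and the GNS representation -/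

section GNS

open scoped InnerProductSpace
open Filter Topology

attribute [local instance] CStarAlgebra.spectralOrder CStarAlgebra.spectralOrderedRing

universe u v

variable {A : Type u} [NonUnitalCStarAlgebra A]

lemma IsPositiveFunctional.map_nonneg {f : A →L[ℂ] ℂ} (hf : IsPositiveFunctional f) {a : A}
    (ha : 0 ≤ a) : 0 ≤ f a := by
  obtain ⟨b, rfl⟩ := CStarAlgebra.nonneg_iff_eq_star_mul_self.mp ha
  exact hf b

lemma IsPositiveFunctional.of_map_nonneg {f : A →L[ℂ] ℂ} (hf : ∀ a : A, 0 ≤ a → 0 ≤ f a) :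
    IsPositiveFunctional f := fun a => hf _ (star_mul_self_nonneg a)

/-- A GNS representation of a functional `f`: a Hilbert space representation `π` with a vector `ξ`
such that `f a = ⟪ξ, π a ξ⟫` and `Λ a = π a ξ` has dense range. -/
structure IsGNS {H : Type v} [NormedAddCommGroup H] [InnerProductSpace ℂ H] [CompleteSpace H]
    (f : A →L[ℂ] ℂ) (Λ : A →L[ℂ] H) (π : A →⋆ₙₐ[ℂ] (H →L[ℂ] H)) (ξ : H) : Prop where
  denseRange : DenseRange Λ
  inner_apply : ∀ a b, ⟪Λ a, Λ b⟫_ℂ = f (star a * b)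
  map_mul : ∀ a b, Λ (a * b) = π a (Λ b)
  apply_vec : ∀ a, π a ξ = Λ a
  eq_inner : ∀ a, f a = ⟪ξ, Λ a⟫_ℂ

/-- Without a unit, the cyclic vector comes from Riesz representation. An approximate unit gives `‖f
a‖ ≤ ‖Λ‖ ‖Λ a‖`, so `f` descends to a bounded functional on the Hilbert space, represented by `ξ`.
Testing against `Λ b` then shows `π a ξ = Λ a`. -/
theorem IsPositiveFunctional.exists_isGNS {f : A →L[ℂ] ℂ} (hf : IsPositiveFunctional f) :
    ∃ (H : Type u) (_ : NormedAddCommGroup H) (_ : InnerProductSpace ℂ H) (_ : CompleteSpace H)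
      (Λ : A →L[ℂ] H) (π : A →⋆ₙₐ[ℂ] (H →L[ℂ] H)) (ξ : H), IsGNS f Λ π ξ := by
  let φ : A →ₚ[ℂ] ℂ := PositiveLinearMap.mk₀ f.toLinearMap fun a ha => hf.map_nonneg ha
  let Λ₀ : A →ₗ[ℂ] φ.GNS :=
    (UniformSpace.Completion.toComplL (𝕜 := ℂ) (E := φ.PreGNS)).toLinearMap ∘ₗ
      φ.toPreGNS.toLinearMap
  have hΛ₀ : ∀ a, Λ₀ a = ((φ.toPreGNS a : φ.PreGNS) : φ.GNS) := fun _ => rfl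
  have hin : ∀ a b, ⟪Λ₀ a, Λ₀ b⟫_ℂ = f (star a * b) := fun a b => by
    rw [hΛ₀, hΛ₀, UniformSpace.Completion.inner_coe, PositiveLinearMap.preGNS_inner_def]
    rfl
  have hnorm : ∀ a, ‖Λ₀ a‖ ^ 2 = (f (star a * a)).re := fun a => by
    rw [← hin, ← inner_self_eq_norm_sq (𝕜 := ℂ)]; rfl
  have hbd : ∀ a, ‖Λ₀ a‖ ≤ √‖f‖ * ‖a‖ := fun a => by
    rw [← sq_le_sq₀ (norm_nonneg _) (by positivity), hnorm, mul_pow,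
      Real.sq_sqrt (norm_nonneg _), sq ‖a‖, ← CStarRing.norm_star_mul_self]
    exact (Complex.re_le_norm _).trans (f.le_opNorm _)
  let Λ : A →L[ℂ] φ.GNS := Λ₀.mkContinuous _ hbd
  have hΛ : ∀ a, Λ a = Λ₀ a := fun _ => rfl
  have hd : DenseRange Λ :=
    UniformSpace.Completion.denseRange_coe.comp φ.toPreGNS.surjective.denseRange
      (UniformSpace.Completion.continuous_coe _)
  have hmul : ∀ a b, Λ (a * b) = φ.gnsNonUnitalStarAlgHom a (Λ b) := fun a b => by
    rw [hΛ, hΛ, hΛ₀, hΛ₀, PositiveLinearMap.gnsNonUnitalStarAlgHom_apply_coe,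
      PositiveLinearMap.leftMulMapPreGNS_apply]
    rfl
  have hle : ∀ a, ‖f a‖ ≤ ‖Λ‖ * ‖Λ a‖ := by
    intro a
    have hu := CStarAlgebra.increasingApproximateUnit A
    have := hu.neBot
    have ht : Tendsto (fun u => ‖f (u * a)‖) (CStarAlgebra.approximateUnit A) (𝓝 ‖f a‖) :=
      ((f.continuous.norm.tendsto _).comp (hu.tendsto_mul_right a))
    refine le_of_tendsto ht ?_
    filter_upwards [hu.eventually_norm, hu.eventually_star_eq] with u hu1 hu2
    rw [← hu2, ← hin, ← hΛ, ← hΛ]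
    refine (norm_inner_le_norm _ _).trans ?_
    gcongr
    exact (Λ.le_opNorm u).trans (mul_le_of_le_one_right (norm_nonneg _) hu1)
  have hd' : DenseRange (Λ : A →ₗ[ℂ] φ.GNS) := hd
  let F : φ.GNS →L[ℂ] ℂ := f.toLinearMap.extendOfNorm Λ.toLinearMap
  have hF : ∀ a, F (Λ a) = f a := LinearMap.extendOfNorm_eq hd' ⟨‖Λ‖, hle⟩
  let ξ := (InnerProductSpace.toDual ℂ φ.GNS).symm F
  have hξ : ∀ v, ⟪ξ, v⟫_ℂ = F v := fun v => InnerProductSpace.toDual_symm_apply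
  refine ⟨φ.GNS, inferInstance, inferInstance, inferInstance, Λ, φ.gnsNonUnitalStarAlgHom, ξ,
    hd, hin, hmul, fun a => ?_, fun a => by rw [hξ, hF]⟩
  refine ext_inner_right ℂ fun v => ?_
  refine hd.induction_on v (isClosed_eq (by fun_prop) (by fun_prop)) fun b => ?_
  rw [hΛ a, hΛ b, hin, ← ContinuousLinearMap.adjoint_inner_right, ← ContinuousLinearMap.star_eq_adjoint,
    ← map_star, ← hΛ b, ← hmul, hξ, hF]

section

variable {H : Type v} [NormedAddCommGroup H] [InnerProductSpace ℂ H] [CompleteSpace H]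
  {f : A →L[ℂ] ℂ} {Λ : A →L[ℂ] H} {π : A →⋆ₙₐ[ℂ] (H →L[ℂ] H)} {ξ : H}

namespace IsGNS

lemma norm_sq (h : IsGNS f Λ π ξ) (a : A) : ‖Λ a‖ ^ 2 = (f (star a * a)).re := by
  rw [← h.inner_apply, ← inner_self_eq_norm_sq (𝕜 := ℂ)]; rfl

lemma adjoint_inner (_ : IsGNS f Λ π ξ) (a : A) (v w : H) :
    ⟪π a v, w⟫_ℂ = ⟪v, π (star a) w⟫_ℂ := by
  rw [map_star, ContinuousLinearMap.star_eq_adjoint, ContinuousLinearMap.adjoint_inner_right]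

lemma vec_ne_zero (h : IsGNS f Λ π ξ) (hf : f ≠ 0) : ξ ≠ 0 := by
  rintro rfl
  exact hf (ContinuousLinearMap.ext fun a => by simp [h.eq_inner a])

end IsGNS

/-- The functional `a ↦ ⟪ξ, V (Λ a)⟫`. -/
noncomputable def vectorFunctional (Λ : A →L[ℂ] H) (ξ : H) (V : H →L[ℂ] H) : A →L[ℂ] ℂ :=
  (innerSL ℂ ξ).comp (V.comp Λ)

omit [CompleteSpace H] in
lemma vectorFunctional_apply (Λ : A →L[ℂ] H) (ξ : H) (V : H →L[ℂ] H) (a : A) :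
    vectorFunctional Λ ξ V a = ⟪ξ, V (Λ a)⟫_ℂ := rfl

namespace IsGNS

/-- This translates order relations between functionals into order relations between operators in
the commutant of `π`. -/
lemma vectorFunctional_star_mul (h : IsGNS f Λ π ξ) {V : H →L[ℂ] H}
    (hV : ∀ a v, V (π a v) = π a (V v)) (a b : A) :
    vectorFunctional Λ ξ V (star a * b) = ⟪Λ a, V (Λ b)⟫_ℂ := by
  rw [vectorFunctional_apply, h.map_mul, hV, ← h.adjoint_inner, h.apply_vec]

lemma vectorFunctional_positive (h : IsGNS f Λ π ξ) {V : H →L[ℂ] H}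
    (hV : ∀ a v, V (π a v) = π a (V v)) (hp : ∀ v, 0 ≤ ⟪v, V v⟫_ℂ) :
    IsPositiveFunctional (vectorFunctional Λ ξ V) := fun a => by
  rw [h.vectorFunctional_star_mul hV]; exact hp _

lemma vectorFunctional_one (h : IsGNS f Λ π ξ) :
    vectorFunctional Λ ξ (ContinuousLinearMap.id ℂ H) = f :=
  ContinuousLinearMap.ext fun a => (h.eq_inner a).symm

end IsGNS

omit [CompleteSpace H] in
lemma vectorFunctional_sub (V W : H →L[ℂ] H) :
    vectorFunctional Λ ξ (V - W) = vectorFunctional Λ ξ V - vectorFunctional Λ ξ W := by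
  ext a; simp [vectorFunctional_apply]

/-- If `g ≤ f`, the GNS representation of `f` is mapped contractively to the one of `g`. -/
lemma IsGNS.exists_intertwiner {K : Type*} [NormedAddCommGroup K] [InnerProductSpace ℂ K]
    [CompleteSpace K] {g : A →L[ℂ] ℂ} {Λ' : A →L[ℂ] K} {π' : A →⋆ₙₐ[ℂ] (K →L[ℂ] K)} {η : K}
    (hf : IsGNS f Λ π ξ) (hg : IsGNS g Λ' π' η) (hle : IsPositiveFunctional (f - g)) :
    ∃ S : H →L[ℂ] K, (∀ a, S (Λ a) = Λ' a) ∧ (∀ v, ‖S v‖ ≤ ‖v‖) ∧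
      ∀ a v, S (π a v) = π' a (S v) := by
  have hn : ∀ a, ‖Λ' a‖ ≤ 1 * ‖Λ a‖ := fun a => by
    rw [one_mul, ← sq_le_sq₀ (norm_nonneg _) (norm_nonneg _), hf.norm_sq, hg.norm_sq]
    have := (hle a).1
    simpa using this
  have hd : DenseRange (Λ : A →ₗ[ℂ] H) := hf.denseRange
  let S : H →L[ℂ] K := Λ'.toLinearMap.extendOfNorm Λ.toLinearMap
  have hS : ∀ a, S (Λ a) = Λ' a := LinearMap.extendOfNorm_eq hd ⟨1, hn⟩
  refine ⟨S, hS, fun v => ?_, fun a v => ?_⟩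
  · simpa using LinearMap.norm_extendOfNorm_apply_le hd 1 hn v
  · refine hf.denseRange.induction_on v (isClosed_eq (by fun_prop) (by fun_prop)) fun b => ?_
    rw [hS, ← hf.map_mul, hS, hg.map_mul]

/-- Commutant of the GNS representation of a pure functional: positive contractions in it are
scalar. -/
lemma IsGNS.eq_smul_of_isPure (h : IsGNS f Λ π ξ) (hf : IsPureFunctional f) {V : H →L[ℂ] H}
    (hV : ∀ a v, V (π a v) = π a (V v)) (hp : ∀ v, 0 ≤ ⟪v, V v⟫_ℂ)
    (hp1 : ∀ v, 0 ≤ ⟪v, v - V v⟫_ℂ) :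
    ∃ α ∈ Set.Icc (0 : ℝ) 1, ∀ v, V v = (α : ℂ) • v := by
  obtain ⟨α, hα, he⟩ := hf.eq_smul_of_le _ (h.vectorFunctional_positive hV hp) (by
    nth_rewrite 1 [← h.vectorFunctional_one]
    rw [← vectorFunctional_sub]
    exact h.vectorFunctional_positive (fun a v => by simp [hV]) (by simpa using hp1))
  refine ⟨α, hα, fun v => ?_⟩
  refine h.denseRange.induction_on v (isClosed_eq (by fun_prop) (by fun_prop)) fun b => ?_
  refine ext_inner_left ℂ fun w => ?_
  refine h.denseRange.induction_on w (isClosed_eq (by fun_prop) (by fun_prop)) fun a => ?_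
  rw [← h.vectorFunctional_star_mul hV, he, inner_smul_right, h.inner_apply]
  rfl

end

/-- The Cauchy–Schwarz inequality for positive functionals. -/
lemma IsPositiveFunctional.norm_apply_star_mul_sq_le {f : A →L[ℂ] ℂ} (hf : IsPositiveFunctional f)
    (a b : A) : ‖f (star a * b)‖ ^ 2 ≤ (f (star a * a)).re * (f (star b * b)).re := by
  obtain ⟨H, _, _, _, Λ, π, ξ, h⟩ := hf.exists_isGNS
  rw [← h.norm_sq, ← h.norm_sq, ← h.inner_apply, ← mul_pow]
  gcongr
  exact norm_inner_le_norm _ _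

/-- Cauchy–Schwarz against the cyclic vector; `‖ξ‖ ^ 2` replaces the missing `f 1`. -/
lemma IsPositiveFunctional.exists_norm_sq_le {f : A →L[ℂ] ℂ} (hf : IsPositiveFunctional f) :
    ∃ C : ℝ, 0 ≤ C ∧ ∀ a, ‖f a‖ ^ 2 ≤ C * (f (star a * a)).re := by
  obtain ⟨H, _, _, _, Λ, π, ξ, h⟩ := hf.exists_isGNS
  refine ⟨‖ξ‖ ^ 2, by positivity, fun a => ?_⟩
  rw [h.eq_inner a, ← h.norm_sq, ← mul_pow]
  gcongr
  exact norm_inner_le_norm _ _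

lemma IsPositiveFunctional.eq_zero_of_star_mul_self {f : A →L[ℂ] ℂ} (hf : IsPositiveFunctional f)
    (h0 : ∀ a, f (star a * a) = 0) : f = 0 := by
  obtain ⟨C, -, hC⟩ := hf.exists_norm_sq_le
  ext a
  have := hC a
  rw [h0] at this
  simpa using this

end GNS

/-! ### Decomposition of positive functionals into pure ones by exhaustion -/

/-- Every nonzero continuous positive functional dominates a pure one. -/
def DominatesPure (A : Type*) [NonUnitalRing A] [StarRing A] [Module ℂ A]
    [TopologicalSpace A] : Prop :=
  ∀ f : A →L[ℂ] ℂ, IsPositiveFunctional f → f ≠ 0 →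
    ∃ h : A →L[ℂ] ℂ, IsPureFunctional h ∧ IsPositiveFunctional (f - h)

section Basic

variable {A : Type*} [NonUnitalRing A] [StarRing A] [Module ℂ A] [TopologicalSpace A]

lemma IsPositiveFunctional.add {f g : A →L[ℂ] ℂ} (hf : IsPositiveFunctional f)
    (hg : IsPositiveFunctional g) : IsPositiveFunctional (f + g) := fun a => by
  simpa using add_nonneg (hf a) (hg a)

lemma IsPositiveFunctional.smul {f : A →L[ℂ] ℂ} (hf : IsPositiveFunctional f) {t : ℝ}
    (ht : 0 ≤ t) : IsPositiveFunctional ((t : ℂ) • f) := fun a => by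
  simpa using mul_nonneg (by exact_mod_cast ht : (0 : ℂ) ≤ t) (hf a)

lemma IsPositiveFunctional.sub_sum {ι : Type*} {f : A →L[ℂ] ℂ} {h : ι → A →L[ℂ] ℂ}
    (hh : ∀ i, IsPositiveFunctional (h i)) (hsum : ∀ a, HasSum (fun i => h i a) (f a))
    (s : Finset ι) : IsPositiveFunctional (f - ∑ i ∈ s, h i) := fun a => by
  simpa using sum_le_hasSum s (fun i _ => hh i a) (hsum (star a * a))

lemma IsPureFunctional.smul {f : A →L[ℂ] ℂ} (hf : IsPureFunctional f) {t : ℝ} (ht : 0 < t) :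
    IsPureFunctional ((t : ℂ) • f) where
  positive := hf.positive.smul ht.le
  ne_zero := smul_ne_zero (by exact_mod_cast ht.ne') hf.ne_zero
  eq_smul_of_le g hg hle := by
    have ht' : (t : ℂ) ≠ 0 := by exact_mod_cast ht.ne'
    obtain ⟨α, hα, he⟩ := hf.eq_smul_of_le (((t⁻¹ : ℝ) : ℂ) • g) (hg.smul (by positivity)) (by
      have := hle.smul (t := t⁻¹) (by positivity)
      rwa [smul_sub, smul_smul, ← Complex.ofReal_mul, inv_mul_cancel₀ ht.ne', Complex.ofReal_one,
        one_smul] at this)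
    refine ⟨α, hα, ?_⟩
    rw [smul_comm, ← he, smul_smul, ← Complex.ofReal_mul, mul_inv_cancel₀ ht.ne',
      Complex.ofReal_one, one_smul]

end Basic

section Exhaustion

attribute [local instance] CStarAlgebra.spectralOrder CStarAlgebra.spectralOrderedRing

variable {A : Type*} [NonUnitalCStarAlgebra A]

/-- On positive elements the sums have nonnegative terms and are bounded by `f`; every element is a
combination of four positive ones. Continuity of the sum is automatic for a positive linear map. -/
lemma IsPositiveFunctional.exists_hasSum {ι : Type*} {f : A →L[ℂ] ℂ} {h : ι → A →L[ℂ] ℂ}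
    (hh : ∀ i, IsPositiveFunctional (h i))
    (hle : ∀ s : Finset ι, IsPositiveFunctional (f - ∑ i ∈ s, h i)) :
    ∃ F : A →L[ℂ] ℂ, IsPositiveFunctional F ∧ IsPositiveFunctional (f - F) ∧
      ∀ a, HasSum (fun i => h i a) (F a) := by
  have hle' : ∀ (s : Finset ι) (a : A), 0 ≤ a → ∑ i ∈ s, h i a ≤ f a := fun s a ha => by
    simpa using (hle s).map_nonneg ha
  have hs0 : ∀ a : A, 0 ≤ a → Summable fun i => h i a := fun a ha => by
    have h1 : ∀ i, h i a = (((h i a).re : ℝ) : ℂ) := fun i => by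
      have := (hh i).map_nonneg ha
      exact Complex.ext rfl (by simpa using this.2.symm)
    have h2 : Summable fun i => (h i a).re :=
      summable_of_sum_le (fun i => ((hh i).map_nonneg ha).1) (c := (f a).re) fun s => by
        simpa using (hle' s a ha).1
    rw [funext h1]
    exact_mod_cast h2
  have hs : ∀ a : A, Summable fun i => h i a := fun a => by
    obtain ⟨x, hx, -, he⟩ := CStarAlgebra.exists_sum_four_nonneg a
    rw [he]
    simp only [map_sum, map_smul]
    exact summable_sum fun j _ => (hs0 (x j) (hx j)).const_smul _
  let F₀ : A →ₗ[ℂ] ℂ :=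
    { toFun := fun a => ∑' i, h i a
      map_add' := fun a b => by simp only [map_add]; exact (hs a).tsum_add (hs b)
      map_smul' := fun c a => by simp only [map_smul]; exact (hs a).tsum_const_smul c }
  have hF₀ : ∀ a, HasSum (fun i => h i a) (F₀ a) := fun a => (hs a).hasSum
  let P : A →ₚ[ℂ] ℂ := PositiveLinearMap.mk₀ F₀ fun a ha =>
    (hF₀ a).nonneg fun i => (hh i).map_nonneg ha
  have hP : ∀ a, P a = F₀ a := fun _ => rfl
  obtain ⟨C, hC⟩ := P.exists_norm_apply_le
  refine ⟨F₀.mkContinuous C hC, fun a => ?_, fun a => ?_, hF₀⟩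
  · exact (hF₀ _).nonneg fun i => hh i a
  · have : F₀ (star a * a) ≤ f (star a * a) :=
      hasSum_le_of_sum_le (hF₀ _) fun s => hle' s _ (star_mul_self_nonneg a)
    simpa [sub_nonneg] using! this

/-- The witness is sought in the open unit ball because the positive elements there are upward
directed, which the countability argument needs. -/
lemma IsPositiveFunctional.exists_pos {h : A →L[ℂ] ℂ} (hp : IsPositiveFunctional h) (h0 : h ≠ 0) :
    ∃ a : A, a ∈ {x : A | 0 ≤ x} ∩ Metric.ball 0 1 ∧ 0 < (h a).re := by
  by_contra! hcon
  refine h0 (hp.eq_zero_of_star_mul_self fun a => ?_)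
  set b := star a * a with hb
  have hb0 : 0 ≤ b := star_mul_self_nonneg a
  have hpos : 0 < (‖b‖ + 1)⁻¹ := by positivity
  have h1 := hcon ((‖b‖ + 1)⁻¹ • b) ⟨smul_nonneg hpos.le hb0, by
    rw [mem_ball_zero_iff, norm_smul, Real.norm_of_nonneg hpos.le, inv_mul_lt_one₀ (by positivity)]
    linarith⟩
  rw [← Complex.coe_smul, map_smul, Complex.coe_smul, Complex.smul_re, smul_eq_mul] at h1
  have h2 := hp.map_nonneg hb0
  have h3 : (h b).re ≤ 0 := by
    by_contra! h4
    exact absurd h1 (not_le.mpr (mul_pos hpos h4))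
  exact Complex.ext (le_antisymm h3 h2.1) h2.2.symm

/-- A family of nonzero positive functionals all of whose finite sums are dominated by a fixed
functional is countable. -/
lemma IsPositiveFunctional.countable_of_sum_le {ι : Type*} {f : A →L[ℂ] ℂ} {h : ι → A →L[ℂ] ℂ}
    (hh : ∀ i, IsPositiveFunctional (h i)) (h0 : ∀ i, h i ≠ 0)
    (hle : ∀ s : Finset ι, IsPositiveFunctional (f - ∑ i ∈ s, h i)) : Countable ι := by
  choose a ha hpos using fun i => (hh i).exists_pos (h0 i)
  have hs : Summable fun i => (h i (a i)).re := by
    refine summable_of_sum_le (fun i => (hpos i).le) (c := ‖f‖) fun s => ?_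
    -- A common upper bound `u` turns the sum over different test elements into one bounded by `f
    -- u`, hence by `‖f‖`.
    obtain ⟨u, hu, hau⟩ : ∃ u ∈ {x : A | 0 ≤ x} ∩ Metric.ball 0 1, ∀ i ∈ s, a i ≤ u := by
      classical
      induction s using Finset.induction_on with
      | empty => exact ⟨0, by simp, by simp⟩
      | insert j t _ ih =>
        obtain ⟨u, hu, hau⟩ := ih
        obtain ⟨v, hv, h1, h2⟩ := CStarAlgebra.directedOn_nonneg_ball _ hu _ (ha j)
        exact ⟨v, hv, fun i hi => by
          rcases Finset.mem_insert.mp hi with rfl | hi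
          exacts [h2, (hau i hi).trans h1]⟩
    calc ∑ i ∈ s, (h i (a i)).re ≤ ∑ i ∈ s, (h i u).re := Finset.sum_le_sum fun i hi => by
          have := ((hh i).map_nonneg (sub_nonneg.mpr (hau i hi))).1
          simpa using this
      _ ≤ (f u).re := by
          have := ((hle s).map_nonneg hu.1).1
          simpa using this
      _ ≤ ‖f‖ * ‖u‖ := (Complex.re_le_norm _).trans (f.le_opNorm _)
      _ ≤ ‖f‖ := mul_le_of_le_one_right (norm_nonneg _) (mem_ball_zero_iff.mp hu.2).le
  have := hs.countable_support
  rw [show Function.support (fun i => (h i (a i)).re) = Set.univ from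
    Set.eq_univ_of_forall fun i => (hpos i).ne'] at this
  exact Set.countable_univ_iff.mp this

/-- Zorn's lemma on sets of pure functionals whose finite sums stay below `f`. If the sum of a
maximal set differs from `f`, the remainder dominates a pure functional, contradicting maximality.
-/
theorem DominatesPure.isScattered (hA : DominatesPure A) : IsScattered A := by
  classical
  intro f hf
  let 𝒮 : Set (Set (A →L[ℂ] ℂ)) := {s | (∀ h ∈ s, IsPureFunctional h) ∧
    ∀ t : Finset (A →L[ℂ] ℂ), (t : Set (A →L[ℂ] ℂ)) ⊆ s → IsPositiveFunctional (f - ∑ h ∈ t, h)}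
  obtain ⟨s, hs⟩ : ∃ s, Maximal (· ∈ 𝒮) s := by
    refine zorn_subset 𝒮 fun c hc hchain => ?_
    rcases c.eq_empty_or_nonempty with rfl | hne
    · refine ⟨∅, ⟨by simp, fun t ht => ?_⟩, by simp⟩
      rw [Set.subset_empty_iff, Finset.coe_eq_empty] at ht
      simpa [ht] using hf
    · refine ⟨⋃₀ c, ⟨fun h ⟨s, hs, hh⟩ => (hc hs).1 h hh, fun t ht => ?_⟩,
        fun s hs => Set.subset_sUnion_of_mem hs⟩
      obtain ⟨s, hs, hts⟩ := DirectedOn.exists_mem_subset_of_finset_subset_biUnion (f := id)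
        hne hchain.directedOn (by rwa [Set.sUnion_eq_biUnion] at ht)
      exact (hc hs).2 t hts
  have hpure : ∀ h : s, IsPureFunctional (h : A →L[ℂ] ℂ) := fun h => hs.prop.1 h h.2
  have hle : ∀ t : Finset s, IsPositiveFunctional (f - ∑ h ∈ t, (h : A →L[ℂ] ℂ)) := fun t => by
    have := hs.prop.2 (t.map (Function.Embedding.subtype _)) (by simp)
    simpa using this
  have hcount : Countable s := IsPositiveFunctional.countable_of_sum_le
    (fun h => (hpure h).positive) (fun h => (hpure h).ne_zero) hle
  obtain ⟨F, -, hfF, hF⟩ := IsPositiveFunctional.exists_hasSum (fun h => (hpure h).positive) hle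
  have hF0 : f = F := by
    by_contra hne
    obtain ⟨h, hh, hhle⟩ := hA (f - F) hfF (sub_ne_zero.mpr hne)
    -- Sets carry no multiplicity and `h` may already belong to `s`. As `s` is countable, some
    -- multiple `t h` with `0 < t < 1` is new.
    obtain ⟨t, ht, hts⟩ : ∃ t ∈ Set.Ioo (0 : ℝ) 1, ((t : ℂ) • h) ∉ s := by
      by_contra! hcon
      have hinj : Function.Injective fun t : ℝ => (t : ℂ) • h := fun t t' htt => by
        simpa using smul_left_injective ℂ hh.ne_zero htt
      have := (Set.countable_coe_iff.mp hcount).preimage_of_injOn hinj.injOn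
      have h2 := this.mono hcon
      rw [← Cardinal.le_aleph0_iff_set_countable, Cardinal.mk_Ioo_real one_pos] at h2
      exact (Cardinal.aleph0_lt_continuum.trans_le h2).false
    have hins : insert ((t : ℂ) • h) s ∈ 𝒮 := by
      refine ⟨fun g hg => ?_, fun T hT => ?_⟩
      · rcases hg with rfl | hg
        exacts [hh.smul ht.1, hs.prop.1 g hg]
      · by_cases hmem : (t : ℂ) • h ∈ T
        · set T' := T.erase ((t : ℂ) • h) with hT'
          have hT's : ∀ g ∈ T', g ∈ s := fun g hg =>
            (hT (Finset.mem_of_mem_erase hg)).resolve_left (Finset.ne_of_mem_erase hg)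
          have h1 := IsPositiveFunctional.sub_sum (fun h => (hpure h).positive) hF (T'.subtype (· ∈ s))
          rw [Finset.sum_subtype_of_mem (fun g => g) hT's] at h1
          have h2 := hh.positive.smul (t := 1 - t) (by linarith [ht.2])
          -- The difference splits as `(f - F - h) + (1 - t) h + (F - ∑ T')`.
          convert (hhle.add h2).add h1 using 1
          rw [← Finset.add_sum_erase _ _ hmem, ← hT', Complex.ofReal_sub, Complex.ofReal_one]
          module
        · exact hs.prop.2 T fun g hg => (hT hg).resolve_left fun he => hmem (he ▸ hg)
    exact hts (hs.le_of_ge hins (Set.subset_insert _ _) (Set.mem_insert _ _))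
  -- The index set must live in the lowest universe, so `s` is replaced by a subset of `ℕ`.
  obtain ⟨e, he⟩ := hcount.exists_injective_nat
  let E : s ≃ Set.range e := Equiv.ofInjective e he
  refine ⟨Set.range e, inferInstance, fun n => (E.symm n : A →L[ℂ] ℂ), fun n => hpure _, fun a => ?_⟩
  rw [hF0]
  exact (E.symm.hasSum_iff (f := fun h : s => (h : A →L[ℂ] ℂ) a)).mpr (hF a)

end Exhaustion

/-! ### Transfer of functionals along ⋆-homomorphisms with dense range to C⋆-algebras -/

section Transfer

variable {X Y : Type*} [NonUnitalRing X] [StarRing X] [Module ℂ X] [TopologicalSpace X]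
  [NonUnitalCStarAlgebra Y]

/-- A continuous ⋆-homomorphism as a continuous linear map. -/
def NonUnitalStarAlgHom.toCLM (j : X →⋆ₙₐ[ℂ] Y) (hj : Continuous j) : X →L[ℂ] Y where
  toFun := j
  map_add' := map_add j
  map_smul' := map_smul j
  cont := hj

variable {j : X →⋆ₙₐ[ℂ] Y} (hj : Continuous j)

lemma IsPositiveFunctional.comp {f : Y →L[ℂ] ℂ} (hf : IsPositiveFunctional f) :
    IsPositiveFunctional (f.comp (j.toCLM hj)) := fun a => by
  have := hf (j a)
  rwa [← map_star, ← map_mul] at this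

variable (hd : DenseRange j)
include hd

lemma IsPositiveFunctional.of_comp {f : Y →L[ℂ] ℂ}
    (hf : IsPositiveFunctional (f.comp (j.toCLM hj))) : IsPositiveFunctional f := fun y => by
  refine hd.induction_on y (isClosed_le (by fun_prop) (by fun_prop)) fun a => ?_
  rw [← map_star, ← map_mul]
  exact hf a

lemma comp_toCLM_injective :
    Function.Injective fun f : Y →L[ℂ] ℂ => f.comp (j.toCLM hj) := fun f g hfg =>
  ContinuousLinearMap.ext fun y => hd.induction_on y (isClosed_eq (by fun_prop) (by fun_prop))
    fun a => congrArg (fun h : X →L[ℂ] ℂ => h a) hfg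

lemma exists_comp_eq {g : X →L[ℂ] ℂ} {C : ℝ} (hC : ∀ x, ‖g x‖ ≤ C * ‖j x‖) :
    ∃ g' : Y →L[ℂ] ℂ, g'.comp (j.toCLM hj) = g := by
  let J : X →ₗ[ℂ] Y := (j.toCLM hj).toLinearMap
  have hJ : DenseRange J := hd
  exact ⟨g.toLinearMap.extendOfNorm J,
    ContinuousLinearMap.ext fun x => LinearMap.extendOfNorm_eq hJ ⟨C, hC⟩ x⟩

variable (hX : ∀ g : X →L[ℂ] ℂ, IsPositiveFunctional g →
  ∃ C : ℝ, 0 ≤ C ∧ ∀ a, ‖g a‖ ^ 2 ≤ C * (g (star a * a)).re)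
include hX

/-- Domination forces continuity for the norm of `Y`: `‖g x‖² ≤ C g(x⋆x) ≤ C f(j(x)⋆j(x)) ≤ C ‖f‖ ‖j
x‖²`. So everything below `f ∘ j` already comes from `Y`, and purity can be compared on both sides.
-/
lemma IsPositiveFunctional.exists_comp_eq_of_le {f : Y →L[ℂ] ℂ} {g : X →L[ℂ] ℂ}
    (hg : IsPositiveFunctional g) (hle : IsPositiveFunctional (f.comp (j.toCLM hj) - g)) :
    ∃ g' : Y →L[ℂ] ℂ, g'.comp (j.toCLM hj) = g ∧ IsPositiveFunctional g' ∧
      IsPositiveFunctional (f - g') := by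
  obtain ⟨C, hC0, hC⟩ := hX g hg
  obtain ⟨g', rfl⟩ := exists_comp_eq hj hd (g := g) (C := √(C * ‖f‖)) fun x => by
    rw [← sq_le_sq₀ (norm_nonneg _) (by positivity), mul_pow, Real.sq_sqrt (by positivity)]
    calc ‖g x‖ ^ 2 ≤ C * (g (star x * x)).re := hC x
      _ ≤ C * (‖f‖ * ‖j x‖ ^ 2) := by
        gcongr
        have h1 : (g (star x * x)).re ≤ (f (j (star x * x))).re := by
          have : 0 ≤ (f (j (star x * x)) - g (star x * x)).re := (hle x).1
          rwa [Complex.sub_re, sub_nonneg] at this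
        refine h1.trans ((Complex.re_le_norm _).trans ((f.le_opNorm _).trans ?_))
        rw [map_mul, map_star, CStarRing.norm_star_mul_self, sq]
      _ = C * ‖f‖ * ‖j x‖ ^ 2 := by ring
  exact ⟨g', rfl, hg.of_comp hj hd, IsPositiveFunctional.of_comp hj hd hle⟩

lemma IsPureFunctional.comp {f : Y →L[ℂ] ℂ} (hf : IsPureFunctional f) :
    IsPureFunctional (f.comp (j.toCLM hj)) where
  positive := hf.positive.comp hj
  ne_zero h0 := hf.ne_zero (comp_toCLM_injective hj hd (by simpa using h0))
  eq_smul_of_le g hg hle := by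
    obtain ⟨g', rfl, hg', hle'⟩ := hg.exists_comp_eq_of_le hj hd hX hle
    obtain ⟨α, hα, rfl⟩ := hf.eq_smul_of_le g' hg' hle'
    exact ⟨α, hα, rfl⟩

omit hX in
include hj in
lemma IsPureFunctional.of_comp {f : Y →L[ℂ] ℂ}
    (hf : IsPureFunctional (f.comp (j.toCLM hj))) : IsPureFunctional f where
  positive := hf.positive.of_comp hj hd
  ne_zero := by rintro rfl; exact hf.ne_zero rfl
  eq_smul_of_le g hg hle := by
    obtain ⟨α, hα, he⟩ := hf.eq_smul_of_le _ (hg.comp hj) (hle.comp hj)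
    exact ⟨α, hα, comp_toCLM_injective hj hd he⟩

include hj in
-- Any one summand in a decomposition of `f ∘ j` is dominated by `f ∘ j` and so descends to `Y`. A
-- summand exists, since an empty sum would give `f = 0`.
lemma IsScattered.dominatesPure (hs : IsScattered X) : DominatesPure Y := by
  intro f hf hf0
  obtain ⟨ι, -, F, hF, hsum⟩ := hs _ (hf.comp hj)
  obtain ⟨i⟩ : Nonempty ι := by
    by_contra hι
    rw [not_nonempty_iff] at hι
    refine hf0 (comp_toCLM_injective hj hd (ContinuousLinearMap.ext fun a => ?_))
    exact (hsum a).unique hasSum_empty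
  have hle := IsPositiveFunctional.sub_sum (fun i => (hF i).positive) hsum {i}
  rw [Finset.sum_singleton] at hle
  obtain ⟨h, he, -, hle'⟩ := (hF i).positive.exists_comp_eq_of_le hj hd hX hle
  exact ⟨h, IsPureFunctional.of_comp hj hd (he ▸ hF i), hle'⟩

end Transfer

/-! ### Continuous functionals on locally C⋆-algebras -/

section LocallyCStar

lemma WithSeminorms.exists_norm_le {X : Type*} [AddCommGroup X] [Module ℂ X] [TopologicalSpace X]
    {Γ : Set (Seminorm ℂ X)} (hne : Γ.Nonempty) (hdir : DirectedOn (· ≤ ·) Γ)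
    (hΓ : WithSeminorms (fun p : Γ => (p : Seminorm ℂ X))) (f : X →L[ℂ] ℂ) :
    ∃ p ∈ Γ, ∃ C : ℝ, ∀ x, ‖f x‖ ≤ C * p x := by
  let q : Seminorm ℂ X := (normSeminorm ℂ ℂ).comp f.toLinearMap
  obtain ⟨s, C, -, hC⟩ := Seminorm.bound_of_continuous hΓ q (f.continuous.norm)
  obtain ⟨p, hp, hps⟩ : ∃ p ∈ Γ, s.sup (fun p : Γ => (p : Seminorm ℂ X)) ≤ p := by
    classical
    clear hC
    induction s using Finset.induction_on with
    | empty => exact ⟨_, hne.some_mem, bot_le⟩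
    | insert r s _ ih =>
      obtain ⟨p, hp, hps⟩ := ih
      obtain ⟨p', hp', h1, h2⟩ := hdir _ hp _ r.2
      exact ⟨p', hp', by rw [Finset.sup_insert]; exact sup_le h2 (hps.trans h1)⟩
  refine ⟨p, hp, C, fun x => (hC x).trans ?_⟩
  exact mul_le_mul_of_nonneg_left (hps x) C.2

variable {X : Type*} [NonUnitalRing X] [StarRing X] [Module ℂ X]
  [IsScalarTower ℂ X X] [SMulCommClass ℂ X X] [StarModule ℂ X] [UniformSpace X]

omit [UniformSpace X] in
omit [IsScalarTower ℂ X X] [SMulCommClass ℂ X X] [StarModule ℂ X] in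
lemma WithSeminorm.continuous_toCompletion [TopologicalSpace X] [IsTopologicalAddGroup X]
    {p : Seminorm ℂ X} [Fact (IsCStarSeminorm p)] (hp : Continuous p) :
    Continuous (WithSeminorm.toCompletion p) := by
  refine continuous_of_continuousAt_zero (WithSeminorm.toCompletion p) ?_
  rw [ContinuousAt, map_zero, tendsto_zero_iff_norm_tendsto_zero]
  simp only [WithSeminorm.norm_toCompletion]
  simpa using hp.tendsto 0

/-- A single seminorm bounds `g`, so `g` extends to a positive functional on a C⋆-completion, where
the GNS estimate applies. -/
lemma IsLocallyCStarAlgebra.exists_norm_sq_le (hX : IsLocallyCStarAlgebra X) (g : X →L[ℂ] ℂ)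
    (hg : IsPositiveFunctional g) :
    ∃ C : ℝ, 0 ≤ C ∧ ∀ a, ‖g a‖ ^ 2 ≤ C * (g (star a * a)).re := by
  obtain ⟨Γ, hne, hdir, hcs, hΓ⟩ := hX.exists_seminorms
  obtain ⟨p, hp, C, hC⟩ := hΓ.exists_norm_le hne hdir g
  have : Fact (IsCStarSeminorm p) := ⟨hcs p hp⟩
  have := hX.isUniformAddGroup
  have hj := WithSeminorm.continuous_toCompletion (hΓ.continuous_seminorm ⟨p, hp⟩)
  have hd := WithSeminorm.denseRange_toCompletion p
  obtain ⟨g', rfl⟩ := exists_comp_eq hj hd (g := g) (C := C) fun x => by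
    rw [WithSeminorm.norm_toCompletion]; exact hC x
  obtain ⟨C', hC0', hC'⟩ := (hg.of_comp hj hd).exists_norm_sq_le
  refine ⟨C', hC0', fun a => ?_⟩
  have := hC' (WithSeminorm.toCompletion p a)
  rwa [← map_star, ← map_mul] at this

end LocallyCStar

/-! ### Pure functionals dominated by a functional with a diffuse centralizer -/

section Centralizer

open scoped InnerProductSpace
open ContinuousLinearMap (adjoint)

variable {A : Type*} [NonUnitalCStarAlgebra A]

lemma adjoint_intertwines {H K : Type*} [NormedAddCommGroup H] [InnerProductSpace ℂ H]
    [CompleteSpace H] [NormedAddCommGroup K] [InnerProductSpace ℂ K] [CompleteSpace K]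
    {π : A →⋆ₙₐ[ℂ] (H →L[ℂ] H)} {π' : A →⋆ₙₐ[ℂ] (K →L[ℂ] K)} {S : H →L[ℂ] K}
    (hS : ∀ a v, S (π a v) = π' a (S v)) (a : A) (v : K) :
    adjoint S (π' a v) = π a (adjoint S v) := by
  refine ext_inner_right ℂ fun w => ?_
  have h1 : ∀ b, adjoint (π b) = π (star b) := fun b => (map_star π b).symm
  have h2 : ∀ b, adjoint (π' b) = π' (star b) := fun b => (map_star π' b).symm
  rw [ContinuousLinearMap.adjoint_inner_left, ← ContinuousLinearMap.adjoint_inner_right, h2, ← hS,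
    ← ContinuousLinearMap.adjoint_inner_left, ← h1, ContinuousLinearMap.adjoint_inner_right]

/-- Right multiplication by a self-adjoint element centralizing `f`. -/
lemma IsGNS.exists_rightMul {H : Type*} [NormedAddCommGroup H] [InnerProductSpace ℂ H]
    [CompleteSpace H] {f : A →L[ℂ] ℂ} {Λ : A →L[ℂ] H} {π : A →⋆ₙₐ[ℂ] (H →L[ℂ] H)} {ξ : H}
    (hf : IsGNS f Λ π ξ) {d : A} (hd : IsSelfAdjoint d) (hcomm : ∀ x, f (x * d) = f (d * x))
    {C : ℝ} (hC : 0 ≤ C)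
    (hbd : ∀ x, (f (star x * x * (d * d))).re ≤ C * (f (star x * x)).re) :
    ∃ R : H →L[ℂ] H, (∀ x, R (Λ x) = Λ (x * d)) ∧ (∀ a v, R (π a v) = π a (R v)) ∧
      adjoint R = R := by
  -- Centrality moves the left factor `d` of `d x⋆ x d` to the right.
  have hn : ∀ x, ‖Λ (x * d)‖ ^ 2 = (f (star x * x * (d * d))).re := fun x => by
    rw [hf.norm_sq, star_mul, hd.star_eq, mul_assoc, ← hcomm]
    simp only [mul_assoc]
  have hdense : DenseRange (Λ : A →ₗ[ℂ] H) := hf.denseRange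
  let L : A →ₗ[ℂ] H := Λ.toLinearMap ∘ₗ LinearMap.mulRight ℂ d
  have hL : ∀ x, L x = Λ (x * d) := fun _ => rfl
  have hLbd : ∀ x, ‖L x‖ ≤ √C * ‖Λ x‖ := fun x => by
    rw [← sq_le_sq₀ (norm_nonneg _) (by positivity), mul_pow, Real.sq_sqrt hC, hL, hn, hf.norm_sq]
    exact hbd x
  let R : H →L[ℂ] H := L.extendOfNorm Λ.toLinearMap
  have hR : ∀ x, R (Λ x) = Λ (x * d) := LinearMap.extendOfNorm_eq hdense ⟨_, hLbd⟩
  refine ⟨R, hR, fun a v => ?_, ?_⟩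
  · refine hf.denseRange.induction_on v (isClosed_eq (by fun_prop) (by fun_prop)) fun b => ?_
    rw [hR, ← hf.map_mul, hR, ← hf.map_mul, mul_assoc]
  · symm
    rw [ContinuousLinearMap.eq_adjoint_iff]
    intro v w
    refine hf.denseRange.induction_on v (isClosed_eq (by fun_prop) (by fun_prop)) fun x => ?_
    refine hf.denseRange.induction_on w (isClosed_eq (by fun_prop) (by fun_prop)) fun y => ?_
    rw [hR, hR, hf.inner_apply, hf.inner_apply, star_mul, hd.star_eq, mul_assoc, ← hcomm, mul_assoc]

/-- Let `h ≤ f` with `h` pure, and let `d i` be a finite family in the centralizer of `f`, with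
`∑ (d i) ^ 4` acting as a unit for `f` and `f ∑ (d i) ^ 2 ≤ 2 f`. If `f (k² (d i)²) ≤ ε` for
all `i`, then `h (k²) ≤ 2 ε`. -/
lemma IsPureFunctional.apply_sq_le {f h : A →L[ℂ] ℂ} (hfp : IsPositiveFunctional f)
    (hh : IsPureFunctional h) (hle : IsPositiveFunctional (f - h)) {ι : Type*} (s : Finset ι)
    (d : ι → A) (hd : ∀ i, IsSelfAdjoint (d i)) (hcomm : ∀ i x, f (x * d i) = f (d i * x))
    (hbd : ∀ x, ∑ i ∈ s, (f (star x * x * (d i * d i))).re ≤ 2 * (f (star x * x)).re)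
    (hbd' : ∀ i x, (f (star x * x * (d i * d i))).re ≤ 2 * (f (star x * x)).re)
    (hone : ∀ x, f (x * ∑ i ∈ s, d i * d i * (d i * d i)) = f x)
    {k : A} (hk : IsSelfAdjoint k) (hkd : ∀ i, Commute k (d i)) {ε : ℝ}
    (hε : 0 ≤ ε) (hsmall : ∀ i, (f (k * k * (d i * d i))).re ≤ ε) : (h (k * k)).re ≤ 2 * ε := by
  obtain ⟨H, _, _, _, Λ, π, ξ, hf⟩ := hfp.exists_isGNS
  obtain ⟨K, _, _, _, Λ', π', η, hg⟩ := hh.positive.exists_isGNS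
  obtain ⟨S, hS, hS1, hSπ⟩ := hf.exists_intertwiner hg hle
  choose R hR hRπ hRadj using fun i =>
    hf.exists_rightMul (hd i) (hcomm i) (C := 2) zero_le_two (hbd' i)
  have hn : ∀ i x, ‖R i (Λ x)‖ ^ 2 = (f (star x * x * (d i * d i))).re := fun i x => by
    rw [hR, hf.norm_sq, star_mul, (hd i).star_eq, mul_assoc, ← hcomm]
    simp only [mul_assoc]
  have hRsum : ∀ u, ∑ i ∈ s, ‖R i u‖ ^ 2 ≤ 2 * ‖u‖ ^ 2 := fun u => by
    refine hf.denseRange.induction_on u (isClosed_le (by fun_prop) (by fun_prop)) fun x => ?_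
    simp only [hn, hf.norm_sq]
    exact hbd x
  have hR1 : ∀ i u, ‖R i u‖ ^ 2 ≤ 2 * ‖u‖ ^ 2 := fun i u => by
    refine hf.denseRange.induction_on u (isClosed_le (by fun_prop) (by fun_prop)) fun x => ?_
    simp only [hn, hf.norm_sq]
    exact hbd' i x
  -- `M i` intertwines `π` and `π'`, so `M i (M i)⋆` lies in the commutant of `π'`, which purity of
  -- `h` makes scalar.
  let M : ι → H →L[ℂ] K := fun i => S.comp (R i)
  have hMadj : ∀ i v, adjoint (M i) v = R i (adjoint S v) := fun i v => by
    rw [ContinuousLinearMap.adjoint_comp, hRadj]; rfl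
  have hMπ : ∀ i a v, M i (π a v) = π' a (M i v) := fun i a v => by
    simp only [M, ContinuousLinearMap.comp_apply, hRπ, hSπ]
  have hSadj : ∀ v, ‖adjoint S v‖ ≤ ‖v‖ := fun v => by
    refine ((adjoint S).le_opNorm v).trans (mul_le_of_le_one_left (norm_nonneg _) ?_)
    rw [LinearIsometryEquiv.norm_map]
    exact S.opNorm_le_bound zero_le_one (by simpa using hS1)
  have hself : ∀ {E : Type _} [NormedAddCommGroup E] [InnerProductSpace ℂ E] (v : E),
      ⟪v, v⟫_ℂ = ((‖v‖ ^ 2 : ℝ) : ℂ) := fun v => by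
    rw [inner_self_eq_norm_sq_to_K]; norm_cast
  have hinner : ∀ i v, ⟪v, M i (adjoint (M i) v)⟫_ℂ = ((‖adjoint (M i) v‖ ^ 2 : ℝ) : ℂ) :=
    fun i v => by
      rw [← ContinuousLinearMap.adjoint_inner_left, hself]
  have hscal : ∀ i, ∃ w : ℝ, 0 ≤ w ∧ ∀ v, ‖adjoint (M i) v‖ ^ 2 = w * ‖v‖ ^ 2 := fun i => by
    -- The factor `1 / 2` makes the operator a contraction, as `‖R i u‖² ≤ 2 ‖u‖²`; it is undone by
    -- `w = 2 α`.
    obtain ⟨α, hα, he⟩ := hg.eq_smul_of_isPure hh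
      (V := ((1 / 2 : ℝ) : ℂ) • (M i).comp (adjoint (M i))) (fun a v => by
        simp [adjoint_intertwines (hMπ i), hMπ]) (fun v => by
        simp only [smul_apply, ContinuousLinearMap.comp_apply,
          inner_smul_right, hinner, ← Complex.ofReal_mul]
        exact_mod_cast (by positivity : (0 : ℝ) ≤ 1 / 2 * ‖adjoint (M i) v‖ ^ 2)) (fun v => by
        simp only [smul_apply, ContinuousLinearMap.comp_apply,
          inner_smul_right, inner_sub_right, hinner, ← Complex.ofReal_mul,
          hself]
        have h1 : ‖adjoint (M i) v‖ ^ 2 ≤ 2 * ‖v‖ ^ 2 := by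
          rw [hMadj]
          refine (hR1 i _).trans ?_
          gcongr
          exact hSadj v
        have h2 : (0 : ℝ) ≤ ‖v‖ ^ 2 - 1 / 2 * ‖adjoint (M i) v‖ ^ 2 := by linarith
        exact_mod_cast h2)
    refine ⟨2 * α, by linarith [hα.1], fun v => ?_⟩
    have h1 := congrArg (fun x => ⟪v, x⟫_ℂ) (he v)
    simp only [smul_apply, ContinuousLinearMap.comp_apply,
      inner_smul_right, hinner, hself] at h1
    have h2 : 1 / 2 * ‖adjoint (M i) v‖ ^ 2 = α * ‖v‖ ^ 2 := by exact_mod_cast h1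
    linarith
  choose w hw0 hw using hscal
  -- Evaluate at the nonzero vector `η`: `∑ w i ‖η‖² = ∑ ‖R i (S⋆ η)‖² ≤ 2 ‖S⋆ η‖²`.
  have hwsum : ∑ i ∈ s, w i ≤ 2 := by
    have hη := hg.vec_ne_zero hh.ne_zero
    have h1 : (∑ i ∈ s, w i) * ‖η‖ ^ 2 ≤ 2 * ‖η‖ ^ 2 := by
      rw [Finset.sum_mul]
      simp only [← hw, hMadj]
      refine (hRsum _).trans ?_
      gcongr
      exact hSadj η
    exact le_of_mul_le_mul_right h1 (by positivity)
  -- Knowing `‖(M i)⋆ v‖² = w i ‖v‖²`, the same bound for `M i` follows from `‖M i u‖² ≤ ‖u‖ ‖(M i)⋆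
  -- M i u‖`.
  have hMle : ∀ i u, ‖M i u‖ ^ 2 ≤ w i * ‖u‖ ^ 2 := fun i u => by
    have h1 : ‖M i u‖ ^ 2 ≤ ‖u‖ * ‖adjoint (M i) (M i u)‖ := by
      rw [← inner_self_eq_norm_sq (𝕜 := ℂ), ← ContinuousLinearMap.adjoint_inner_right]
      exact (RCLike.re_le_norm _).trans (norm_inner_le_norm _ _)
    have h2 : (‖M i u‖ ^ 2) ^ 2 ≤ w i * ‖u‖ ^ 2 * ‖M i u‖ ^ 2 := by
      calc (‖M i u‖ ^ 2) ^ 2 ≤ (‖u‖ * ‖adjoint (M i) (M i u)‖) ^ 2 := by gcongr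
        _ = w i * ‖u‖ ^ 2 * ‖M i u‖ ^ 2 := by rw [mul_pow, hw]; ring
    rcases eq_or_lt_of_le (sq_nonneg ‖M i u‖) with h0 | h0
    · rw [← h0]; exact mul_nonneg (hw0 i) (sq_nonneg _)
    · rw [sq (‖M i u‖ ^ 2)] at h2
      exact le_of_mul_le_mul_right h2 h0
  set e : A := ∑ i ∈ s, d i * d i * (d i * d i) with he
  have hΛe : ∀ x, Λ (x * e) = Λ x := fun x => by
    rw [← sub_eq_zero, ← map_sub, ← norm_eq_zero, ← sq_eq_zero_iff, hf.norm_sq, mul_sub,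
      ← mul_assoc, map_sub, hone, sub_self, Complex.zero_re]
  -- One factor `d i` is absorbed into `R i`, giving `M i (Λ (k d)) = Λ' (k d²)`; its squared norm
  -- is `h (k² d⁴)` because `k` commutes with `d i`.
  have hcalc : ∀ i, (h (k * (k * (d i * d i * (d i * d i))))).re = ‖M i (Λ (k * d i))‖ ^ 2 := by
    intro i
    have hk' : Commute (k * (d i * d i)) (d i * d i) :=
      (((hkd i).mul_right (hkd i)).mul_left (Commute.refl _))
    have hk'' : Commute k (d i * d i) := (hkd i).mul_right (hkd i)
    simp only [M, ContinuousLinearMap.comp_apply, hR, hS, hg.norm_sq]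
    congr 2
    simp only [star_mul, (hd i).star_eq, hk.star_eq]
    rw [mul_assoc k (d i) (d i), ← mul_assoc (d i) (d i) k, ← hk''.eq]
    simp only [mul_assoc]
    congr 1
    simp only [← mul_assoc]
    rw [mul_assoc k, hk''.eq]
  calc (h (k * k)).re = (h (k * (k * e))).re := by
        have h1 : Λ' (k * e) = Λ' k := by rw [← hS, hΛe, hS]
        have h2 := hg.inner_apply k k
        have h3 := hg.inner_apply k (k * e)
        rw [h1, h2, hk.star_eq] at h3
        rw [h3]
    _ = ∑ i ∈ s, ‖M i (Λ (k * d i))‖ ^ 2 := by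
        simp only [he, Finset.mul_sum, map_sum, Complex.re_sum, hcalc]
    _ ≤ ∑ i ∈ s, w i * ε := by
        refine Finset.sum_le_sum fun i _ => (hMle i _).trans ?_
        refine mul_le_mul_of_nonneg_left ?_ (hw0 i)
        rw [← hR, hn, hk.star_eq]
        exact hsmall i
    _ ≤ 2 * ε := by
        rw [← Finset.sum_mul]
        exact mul_le_mul_of_nonneg_right hwsum hε

end Centralizer

/-! ### States at points of the spectrum -/

section States

attribute [local instance] CStarAlgebra.spectralOrder CStarAlgebra.spectralOrderedRing

section Unital

variable {U : Type*} [CStarAlgebra U]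

/-- A noninvertible positive element is annihilated by a state. -/
lemma exists_state_apply_eq_zero {c : U} (hc : 0 ≤ c) (hcu : ¬ IsUnit c) :
    ∃ φ : U →L[ℂ] ℂ, IsPositiveFunctional φ ∧ φ 1 = 1 ∧ φ c = 0 := by
  have hnt : Nontrivial U := by
    by_contra hU
    rw [not_nontrivial_iff_subsingleton] at hU
    exact hcu (isUnit_of_subsingleton c)
  have h10 : (0 : U) ≤ 1 := zero_le_one
  -- Hahn–Banach is applied to elements whose real part is bounded below by a positive scalar modulo
  -- real multiples of `c`. This set misses `0`: an inequality `ε ≤ β c` would force `β > 0` and `c`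
  -- invertible.
  let K : Set U := {x | ∃ β ε : ℝ, 0 < ε ∧ ε • (1 : U) ≤ x + star x + β • c}
  have hconv : Convex ℝ K := by
    rintro x ⟨β, ε, hε, hx⟩ y ⟨β', ε', hε', hy⟩ p q hp hq hpq
    refine ⟨p * β + q * β', p * ε + q * ε', ?_, ?_⟩
    · rcases hp.eq_or_lt with rfl | hp
      · have : q = 1 := by simpa using hpq
        simpa [this] using hε'
      · positivity
    · calc (p * ε + q * ε') • (1 : U) = p • ε • (1 : U) + q • ε' • (1 : U) := by module
        _ ≤ p • (x + star x + β • c) + q • (y + star y + β' • c) :=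
          add_le_add (smul_le_smul_of_nonneg_left hx hp) (smul_le_smul_of_nonneg_left hy hq)
        _ = _ := by
          simp only [star_add, star_smul, star_trivial]
          module
  have hopen : IsOpen K := by
    rw [Metric.isOpen_iff]
    rintro x ⟨β, ε, hε, hx⟩
    refine ⟨ε / 4, by positivity, fun y hy => ⟨β, ε / 2, by positivity, ?_⟩⟩
    rw [mem_ball_iff_norm] at hy
    have hsa : IsSelfAdjoint (y - x + star (y - x)) := IsSelfAdjoint.add_star_self _
    have h1 := hsa.neg_algebraMap_norm_le_self
    have h2 : ‖y - x + star (y - x)‖ ≤ ε / 2 := by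
      refine (norm_add_le _ _).trans ?_
      rw [norm_star]; linarith
    have h3 : -((ε / 2) • (1 : U)) ≤ y - x + star (y - x) := by
      refine le_trans ?_ h1
      rw [Algebra.algebraMap_eq_smul_one]
      exact neg_le_neg (smul_le_smul_of_nonneg_right h2 h10)
    calc (ε / 2) • (1 : U) = ε • (1 : U) + -((ε / 2) • (1 : U)) := by module
      _ ≤ (x + star x + β • c) + (y - x + star (y - x)) := add_le_add hx h3
      _ = _ := by rw [star_sub]; abel
  have h0 : (0 : U) ∉ K := by
    rintro ⟨β, ε, hε, hx⟩
    rw [star_zero, add_zero, zero_add] at hx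
    rcases le_or_gt β 0 with hβ | hβ
    · have h1 : ε • (1 : U) ≤ 0 := hx.trans (smul_nonpos_of_nonpos_of_nonneg hβ hc)
      have h2 : ε • (1 : U) = 0 := le_antisymm h1 (smul_nonneg hε.le h10)
      rcases smul_eq_zero.mp h2 with h | h
      exacts [hε.ne' h, one_ne_zero h]
    · have h1 : IsUnit (β • c) := by
        refine CStarAlgebra.isUnit_of_le _ hx ⟨smul_nonneg hε.le h10, ?_⟩
        exact (isUnit_one.smul (Units.mk0 ε hε.ne'))
      refine hcu ?_
      have := h1.smul (Units.mk0 β hβ.ne')⁻¹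
      rwa [Units.smul_def, smul_smul, Units.val_inv_eq_inv_val, Units.val_mk0,
        inv_mul_cancel₀ hβ.ne', one_smul] at this
  obtain ⟨f, hf⟩ := geometric_hahn_banach_point_open hconv hopen h0
  simp only [map_zero] at hf
  -- As `f > 0` on `K`, it cannot vary along a line contained in `K`. This kills `c` and all
  -- skew-adjoint elements.
  have hshift : ∀ z : U, (∀ β : ℝ, 1 + β • z ∈ K) → f z = 0 := by
    intro z hz
    by_contra hne
    have := hf _ (hz (-(f 1 / f z)))
    rw [map_add, map_smul, smul_eq_mul, neg_mul, div_mul_cancel₀ _ hne] at this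
    linarith
  have hf1 : 0 < f 1 := hf 1 ⟨0, 2, two_pos, by rw [star_one, zero_smul, add_zero]; exact (by module : (2 : ℝ) • (1 : U) = 1 + 1).le⟩
  have hfc : f c = 0 := hshift c fun β => ⟨-(2 * β), 2, two_pos, by
    refine le_of_eq ?_
    simp only [star_add, star_one, star_smul, star_trivial, (IsSelfAdjoint.of_nonneg hc).star_eq]
    module⟩
  have hskew : ∀ z : U, star z = -z → f z = 0 := fun z hz => hshift z fun β => ⟨0, 2, two_pos, by
    refine le_of_eq ?_
    simp only [star_add, star_one, star_smul, star_trivial, hz]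
    module⟩
  have hpos : ∀ z : U, 0 ≤ z → 0 ≤ f z := fun z hz => by
    by_contra! hneg
    have hmem : -(f z / f 1) • (1 : U) + z ∈ K := by
      have hd : 0 < -(f z / f 1) := by
        rw [neg_pos]; exact div_neg_of_neg_of_pos hneg hf1
      refine ⟨0, 2 * -(f z / f 1), by positivity, ?_⟩
      simp only [star_add, star_one, star_smul, star_trivial, (IsSelfAdjoint.of_nonneg hz).star_eq,
        zero_smul, add_zero]
      rw [← sub_nonneg]
      convert add_nonneg hz hz using 1
      module
    have := hf _ hmem
    rw [map_add, map_smul, smul_eq_mul, neg_mul, div_mul_cancel₀ _ hf1.ne'] at this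
    linarith
  let F : U →L[ℂ] ℂ := f.extendRCLike
  have hF : ∀ z : U, IsSelfAdjoint z → F z = f z := fun z hz => by
    rw [StrongDual.extendRCLike_apply]
    have : f ((RCLike.I : ℂ) • z) = 0 := hskew _ (by
      rw [star_smul, hz.star_eq]
      simp)
    rw [this]
    simp
  have hf1' : ((f 1 : ℝ) : ℂ) ≠ 0 := by exact_mod_cast hf1.ne'
  refine ⟨((f 1 : ℝ) : ℂ)⁻¹ • F, IsPositiveFunctional.of_map_nonneg fun z hz => ?_, ?_, ?_⟩
  · rw [smul_apply, hF z (.of_nonneg hz), smul_eq_mul, ← Complex.ofReal_inv,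
      ← Complex.ofReal_mul]
    exact_mod_cast mul_nonneg (inv_nonneg.mpr hf1.le) (hpos z hz)
  · rw [smul_apply, hF 1 (.one U), smul_eq_mul, inv_mul_cancel₀ hf1']
  · rw [smul_apply, hF c (.of_nonneg hc), hfc]
    simp

lemma IsPositiveFunctional.norm_apply_le {φ : U →L[ℂ] ℂ} (hφ : IsPositiveFunctional φ)
    (h1 : φ 1 = 1) (x : U) : ‖φ x‖ ≤ ‖x‖ := by
  have h2 := hφ.norm_apply_star_mul_sq_le 1 x
  rw [star_one, one_mul, one_mul, h1, Complex.one_re, one_mul] at h2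
  have h3 := (hφ.map_nonneg (sub_nonneg.mpr (CStarAlgebra.star_mul_le_algebraMap_norm_sq (a := x)))).1
  rw [map_sub, Algebra.algebraMap_eq_smul_one, ← Complex.coe_smul, map_smul, h1] at h3
  rw [← sq_le_sq₀ (norm_nonneg _) (norm_nonneg _)]
  refine h2.trans ?_
  simpa [← Complex.ofReal_pow] using h3

/-- At every point `t` of the spectrum of a self-adjoint `b` there is a state which restricts to
evaluation at `t` on the functional calculus of `b` and is multiplicative there. -/
lemma exists_state_of_mem_spectrum {b : U} (hb : IsSelfAdjoint b) {t : ℝ} (ht : t ∈ spectrum ℝ b) :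
    ∃ φ : U →L[ℂ] ℂ, IsPositiveFunctional φ ∧ φ 1 = 1 ∧ ∀ g : ℝ → ℝ, Continuous g → ∀ x,
      φ (x * cfc g b) = g t * φ x ∧ φ (cfc g b * x) = g t * φ x := by
  -- The state is chosen to annihilate `(b - t)²`, which is not invertible because `t` lies in the
  -- spectrum.
  let q : ℝ → ℝ := fun x => (x - t) ^ 2
  have hq : Continuous q := by fun_prop
  have hc0 : 0 ≤ cfc q b := cfc_nonneg fun x _ => sq_nonneg _
  have hcu : ¬ IsUnit (cfc q b) := by
    intro hu
    have h0 : (0 : ℝ) ∈ spectrum ℝ (cfc q b) := by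
      rw [cfc_map_spectrum q b]
      exact ⟨t, ht, by simp [q]⟩
    exact (spectrum.zero_mem_iff ℝ).mp h0 hu
  obtain ⟨φ, hφ, h1, hφc⟩ := exists_state_apply_eq_zero hc0 hcu
  refine ⟨φ, hφ, h1, fun g hg => ?_⟩
  let r : ℝ → ℝ := fun x => g x - g t
  have hr : Continuous r := by fun_prop
  have hrsa : IsSelfAdjoint (cfc r b) := cfc_predicate r b
  have hrb : cfc r b = cfc g b - ((g t : ℝ) : ℂ) • (1 : U) := by
    rw [cfc_sub g (fun _ => g t) b, cfc_const (g t) b, Algebra.algebraMap_eq_smul_one,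
      ← Complex.coe_smul]
  have hr0 : (φ (star (cfc r b) * cfc r b)).re ≤ 0 := by
    refine le_of_forall_pos_le_add fun ε hε => ?_
    rw [hrsa.star_eq, ← cfc_mul r r b]
    -- Near `t` continuity gives `r² ≤ ε`; away from `t`, `q` is bounded below and `r²` is bounded.
    -- Applying `φ` kills the `q` term, and Cauchy–Schwarz then yields multiplicativity on both
    -- sides.
    obtain ⟨C, hC⟩ : ∃ C : ℝ, ∀ x ∈ spectrum ℝ b, r x * r x ≤ ε + C * q x := by
      obtain ⟨M, hM⟩ := (isCompact_iff_compactSpace.mpr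
        (inferInstance : CompactSpace (spectrum ℝ b))).exists_bound_of_continuousOn
        (f := fun x => r x * r x) (by fun_prop)
      have hcont : ContinuousAt (fun x => r x * r x) t := by fun_prop
      obtain ⟨δ, hδ, hδ'⟩ := Metric.continuousAt_iff.mp hcont ε hε
      refine ⟨M / δ ^ 2, fun x hx => ?_⟩
      have hM0 : 0 ≤ M := (norm_nonneg _).trans (hM x hx)
      by_cases hxt : dist x t < δ
      · have h2 := hδ' hxt
        rw [Real.dist_eq] at h2
        simp only [r, sub_self, mul_zero, sub_zero] at h2
        have h3 : 0 ≤ M / δ ^ 2 * q x := mul_nonneg (by positivity) (sq_nonneg _)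
        have h4 := (le_abs_self _).trans h2.le
        simp only [r]; linarith
      · have h2 := (le_abs_self _).trans (hM x hx)
        have h3 : δ ^ 2 ≤ q x := by
          simp only [q, ← sq_abs (x - t), ← Real.dist_eq]
          exact pow_le_pow_left₀ hδ.le (not_lt.mp hxt) 2
        calc r x * r x ≤ M := h2
          _ = M / δ ^ 2 * δ ^ 2 := by field_simp
          _ ≤ M / δ ^ 2 * q x := by gcongr
          _ ≤ ε + M / δ ^ 2 * q x := by linarith
    have h2 : cfc (fun x => r x * r x) b ≤ cfc (fun x => ε + C * q x) b := cfc_mono hC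
    rw [cfc_const_add ε (fun x => C * q x) b, cfc_const_mul C q b,
      Algebra.algebraMap_eq_smul_one] at h2
    have h3 := (hφ.map_nonneg (sub_nonneg.mpr h2)).1
    rw [map_sub, map_add, ← Complex.coe_smul, ← Complex.coe_smul, map_smul, map_smul, h1, hφc] at h3
    simpa using h3
  have hR : ∀ x, φ (x * cfc r b) = 0 := fun x => by
    have h2 := hφ.norm_apply_star_mul_sq_le (star x) (cfc r b)
    rw [star_star] at h2
    have h3 : ‖φ (x * cfc r b)‖ ^ 2 ≤ 0 :=
      h2.trans (mul_nonpos_of_nonneg_of_nonpos (by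
        have := (hφ (star x)).1
        rwa [star_star] at this) hr0)
    simpa using le_antisymm h3 (sq_nonneg _)
  have hL : ∀ x, φ (cfc r b * x) = 0 := fun x => by
    have h2 := hφ.norm_apply_star_mul_sq_le (cfc r b) x
    nth_rewrite 1 [hrsa.star_eq] at h2
    have h3 : ‖φ (cfc r b * x)‖ ^ 2 ≤ 0 :=
      h2.trans (mul_nonpos_of_nonpos_of_nonneg hr0 (hφ x).1)
    simpa using le_antisymm h3 (sq_nonneg _)
  refine fun x => ⟨?_, ?_⟩
  · have := hR x
    rwa [hrb, mul_sub, map_sub, mul_smul_comm, mul_one, map_smul, smul_eq_mul, sub_eq_zero] at this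
  · have := hL x
    rwa [hrb, sub_mul, map_sub, smul_mul_assoc, one_mul, map_smul, smul_eq_mul, sub_eq_zero] at this

end Unital

variable {A : Type*} [NonUnitalCStarAlgebra A]

/-- Restriction of a state of the unitization, where the quasispectrum becomes the spectrum; `g 0 =
0` keeps the functional calculus inside `A`. -/
lemma exists_state_of_mem_quasispectrum {a : A} (ha : IsSelfAdjoint a) {t : ℝ}
    (ht : t ∈ quasispectrum ℝ a) :
    ∃ ψ : A →L[ℂ] ℂ, IsPositiveFunctional ψ ∧ (∀ x, ‖ψ x‖ ≤ ‖x‖) ∧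
      ∀ g : ℝ → ℝ, Continuous g → g 0 = 0 → ψ (cfcₙ g a) = g t ∧
        ∀ x, ψ (x * cfcₙ g a) = g t * ψ x ∧ ψ (cfcₙ g a * x) = g t * ψ x := by
  rw [Unitization.quasispectrum_eq_spectrum_inr' ℝ ℂ a] at ht
  obtain ⟨φ, hφ, h1, hg⟩ := exists_state_of_mem_spectrum (ha.inr ℂ) ht
  let J : A →L[ℂ] Unitization ℂ A := (Unitization.inrNonUnitalStarAlgHom ℂ A).toCLM
    (Unitization.isometry_inr.continuous)
  have hJ : ∀ x, J x = (x : Unitization ℂ A) := fun _ => rfl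
  refine ⟨φ.comp J, hφ.comp _, fun x => ?_, fun g hgc hg0 => ⟨?_, fun x => ?_⟩⟩
  · rw [ContinuousLinearMap.comp_apply, hJ]
    exact (hφ.norm_apply_le h1 _).trans (Unitization.norm_inr (𝕜 := ℂ) x).le
  · have := (hg g hgc 1).1
    rw [one_mul, h1, mul_one] at this
    rw [ContinuousLinearMap.comp_apply, hJ, Unitization.real_cfcₙ_eq_cfc_inr a g hg0, this]
  · simp only [ContinuousLinearMap.comp_apply, hJ, Unitization.inr_mul,
      Unitization.real_cfcₙ_eq_cfc_inr a g hg0]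
    exact hg g hgc x

end States

/-! ### Spectra of self-adjoint elements contain no interval -/

section Diffuse

open Filter Topology

lemma Finset.card_le_of_forall_sub_le {F : Finset ℕ} {L : ℝ} (hL : 0 ≤ L)
    (h : ∀ i ∈ F, ∀ j ∈ F, (j : ℝ) - i ≤ L) : (F.card : ℝ) ≤ L + 1 := by
  rcases F.eq_empty_or_nonempty with rfl | hne
  · simp; positivity
  · have h1 : F ⊆ Finset.Icc (F.min' hne) (F.max' hne) := fun i hi =>
      Finset.mem_Icc.mpr ⟨F.min'_le i hi, F.le_max' i hi⟩
    have h2 := Finset.card_le_card h1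
    rw [Nat.card_Icc] at h2
    have h3 := h _ (F.min'_mem hne) _ (F.max'_mem hne)
    have h4 : F.min' hne ≤ F.max' hne := F.min'_le _ (F.max'_mem hne)
    have h5 : ((F.max' hne + 1 - F.min' hne : ℕ) : ℝ) = F.max' hne + 1 - F.min' hne := by
      push_cast [Nat.cast_sub (h4.trans (Nat.le_succ _))]; ring
    have h6 : (F.card : ℝ) ≤ ((F.max' hne + 1 - F.min' hne : ℕ) : ℝ) := by exact_mod_cast h2
    linarith

lemma card_filter_Ioo_le {s t u v : ℝ} (hst : s < t) (huv : u ≤ v) (m : ℕ) :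
    (((Finset.range (m + 1)).filter
      fun i : ℕ => s + (t - s) * (i / (m + 1)) ∈ Set.Ioo u v).card : ℝ) ≤
      (v - u) / (t - s) * (m + 1) + 1 := by
  have hd : 0 < t - s := sub_pos.mpr hst
  have hm : (0 : ℝ) < m + 1 := by positivity
  refine Finset.card_le_of_forall_sub_le
    (mul_nonneg (div_nonneg (sub_nonneg.mpr huv) hd.le) hm.le) fun i hi j hj => ?_
  have hi' := (Finset.mem_filter.mp hi).2.1
  have hj' := (Finset.mem_filter.mp hj).2.2
  have h1 : (t - s) * (((j : ℝ) - i) / (m + 1)) ≤ v - u := by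
    rw [sub_div, mul_sub]; linarith
  rw [div_mul_eq_mul_div, le_div_iff₀ hd]
  calc ((j : ℝ) - i) * (t - s) = (t - s) * (((j : ℝ) - i) / (m + 1)) * (m + 1) := by
        field_simp
    _ ≤ (v - u) * (m + 1) := by gcongr

variable {A : Type*} [NonUnitalCStarAlgebra A]

/-- Banach–Alaoglu; along an ultrafilter no subsequence is needed. -/
lemma exists_ultrafilter_limit (φ : ℕ → A →L[ℂ] ℂ) (hφ : ∀ m x, ‖φ m x‖ ≤ ‖x‖) :
    ∃ f : A →L[ℂ] ℂ, ∀ x, Tendsto (fun m => φ m x) (hyperfilter ℕ : Filter ℕ) (𝓝 (f x)) := by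
  have hK := WeakDual.isCompact_closedBall (𝕜 := ℂ) (E := A) 0 1
  let Φ : ℕ → WeakDual ℂ A := fun m => StrongDual.toWeakDual (φ m)
  obtain ⟨f, -, hf⟩ := hK.ultrafilter_le_nhds ((hyperfilter ℕ).map Φ) (by
    rw [le_principal_iff]
    refine Filter.mem_map.mpr (Filter.univ_mem' fun m => ?_)
    simp only [Set.mem_preimage, mem_closedBall_zero_iff]
    exact (φ m).opNorm_le_bound zero_le_one (by simpa using hφ m))
  refine ⟨WeakDual.toStrongDual f, fun x => ?_⟩
  exact ((WeakDual.eval_continuous x).tendsto f).comp hf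

/-- A diffuse positive functional centralizing `a`, when the spectrum of `a` contains an
interval. -/
lemma exists_diffuse_functional {a : A} (ha : IsSelfAdjoint a) {s t : ℝ} (hst : s < t)
    (hsp : Set.Icc s t ⊆ quasispectrum ℝ a) :
    ∃ f : A →L[ℂ] ℂ, IsPositiveFunctional f ∧ ∀ g : ℝ → ℝ, Continuous g → g 0 = 0 →
      (∀ x, f (x * cfcₙ g a) = f (cfcₙ g a * x)) ∧
      ((∀ r ∈ Set.Icc s t, g r = 1) → f (cfcₙ g a) = 1 ∧ ∀ x, f (x * cfcₙ g a) = f x) ∧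
      (∀ C : ℝ, (∀ r, g r ≤ C) →
        ∀ x, (f (star x * x * cfcₙ g a)).re ≤ C * (f (star x * x)).re) ∧
      (∀ u v : ℝ, u ≤ v → (∀ r, g r ≤ 1) → (∀ r, r ∉ Set.Ioo u v → g r ≤ 0) →
        (f (cfcₙ g a)).re ≤ (v - u) / (t - s)) := by
  choose! ψ hψ hψ1 hψg using fun r (hr : r ∈ Set.Icc s t) =>
    exists_state_of_mem_quasispectrum ha (hsp hr)
  -- Averaging states at equidistant points imitates Lebesgue measure on `[s, t]`. Each listed
  -- property holds for the averages, up to a counting error `1 / (m + 1)` in the last, and survives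
  -- the limit.
  let p : ℕ → ℕ → ℝ := fun m i => s + (t - s) * (i / (m + 1))
  have hp : ∀ m, ∀ i ∈ Finset.range (m + 1), p m i ∈ Set.Icc s t := fun m i hi => by
    have hi' : (i : ℝ) ≤ m + 1 := by exact_mod_cast (Finset.mem_range.mp hi).le
    have h1 : (i : ℝ) / (m + 1) ≤ 1 := div_le_one_of_le₀ hi' (by positivity)
    have h0 : (0 : ℝ) ≤ i / (m + 1) := by positivity
    constructor <;> simp only [p] <;> nlinarith
  let φ : ℕ → A →L[ℂ] ℂ := fun m =>
    (((m + 1 : ℝ)⁻¹ : ℝ) : ℂ) • ∑ i ∈ Finset.range (m + 1), ψ (p m i)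
  have hφ : ∀ m x, φ m x = (((m + 1 : ℝ)⁻¹ : ℝ) : ℂ) * ∑ i ∈ Finset.range (m + 1), ψ (p m i) x :=
    fun m x => by simp [φ]
  have hφre : ∀ m x, (φ m x).re = (m + 1 : ℝ)⁻¹ * ∑ i ∈ Finset.range (m + 1), (ψ (p m i) x).re :=
    fun m x => by rw [hφ, Complex.re_ofReal_mul, Complex.re_sum]
  have hm0 : ∀ m : ℕ, (0 : ℝ) < (m + 1 : ℝ)⁻¹ := fun m => by positivity
  have hm1 : ∀ m : ℕ, (m + 1 : ℝ)⁻¹ * (m + 1) = 1 := fun m => inv_mul_cancel₀ (by positivity)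
  obtain ⟨f, hf⟩ := exists_ultrafilter_limit φ fun m x => by
    rw [hφ, norm_mul, Complex.norm_real, Real.norm_of_nonneg (hm0 m).le]
    calc (m + 1 : ℝ)⁻¹ * ‖∑ i ∈ Finset.range (m + 1), ψ (p m i) x‖
        ≤ (m + 1 : ℝ)⁻¹ * ∑ i ∈ Finset.range (m + 1), ‖x‖ := by
          gcongr
          exact (norm_sum_le _ _).trans (Finset.sum_le_sum fun i hi => hψ1 _ (hp m i hi) x)
      _ = ‖x‖ := by
          rw [Finset.sum_const, Finset.card_range, nsmul_eq_mul, ← mul_assoc]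
          push_cast
          rw [hm1, one_mul]
  have hfre : ∀ x, Tendsto (fun m => (φ m x).re) (hyperfilter ℕ : Filter ℕ) (𝓝 (f x).re) :=
    fun x => (Complex.continuous_re.tendsto _).comp (hf x)
  refine ⟨f, fun x => ?_, fun g hg hg0 => ⟨fun x => ?_, fun hg1 => ⟨?_, fun x => ?_⟩,
    fun C hC x => ?_, fun u v huv hg1 hgv => ?_⟩⟩
  · refine ge_of_tendsto' (hf _) fun m => ?_
    rw [hφ]
    refine mul_nonneg (by exact_mod_cast (hm0 m).le) (Finset.sum_nonneg fun i hi => ?_)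
    exact hψ _ (hp m i hi) x
  · refine tendsto_nhds_unique (hf _) ((hf (cfcₙ g a * x)).congr fun m => ?_)
    rw [hφ, hφ]
    congr 1
    refine Finset.sum_congr rfl fun i hi => ?_
    have := (hψg _ (hp m i hi) g hg hg0).2 x
    rw [this.1, this.2]
  · refine tendsto_nhds_unique (hf _) (tendsto_const_nhds.congr fun m => ?_)
    rw [hφ, Finset.sum_congr rfl fun i hi => by
      rw [(hψg _ (hp m i hi) g hg hg0).1, hg1 _ (hp m i hi)]]
    rw [Finset.sum_const, Finset.card_range, nsmul_eq_mul, Complex.ofReal_one, mul_one]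
    exact_mod_cast (hm1 m).symm
  · refine tendsto_nhds_unique (hf _) ((hf x).congr fun m => ?_)
    rw [hφ, hφ]
    congr 1
    refine Finset.sum_congr rfl fun i hi => ?_
    rw [((hψg _ (hp m i hi) g hg hg0).2 x).1, hg1 _ (hp m i hi), Complex.ofReal_one, one_mul]
  · refine le_of_tendsto_of_tendsto' (hfre _) ((hfre (star x * x)).const_mul C) fun m => ?_
    rw [hφre, hφre, mul_left_comm C, Finset.mul_sum _ _ C]
    refine mul_le_mul_of_nonneg_left (Finset.sum_le_sum fun i hi => ?_) (hm0 m).le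
    rw [((hψg _ (hp m i hi) g hg hg0).2 _).1, Complex.re_ofReal_mul]
    exact mul_le_mul_of_nonneg_right (hC _) (hψ _ (hp m i hi) x).1
  · have hlim : Tendsto (fun m : ℕ => (v - u) / (t - s) + (m + 1 : ℝ)⁻¹)
        (hyperfilter ℕ : Filter ℕ) (𝓝 ((v - u) / (t - s) + 0)) := by
      have h1 : Tendsto (fun m : ℕ => (m + 1 : ℝ)⁻¹) atTop (𝓝 0) := by
        simpa using tendsto_one_div_add_atTop_nhds_zero_nat (𝕜 := ℝ)
      exact (h1.mono_left Nat.hyperfilter_le_atTop).const_add _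
    rw [add_zero] at hlim
    refine le_of_tendsto_of_tendsto' (hfre _) hlim fun m => ?_
    rw [hφre]
    have h1 : ∑ i ∈ Finset.range (m + 1), (ψ (p m i) (cfcₙ g a)).re ≤
        (((Finset.range (m + 1)).filter fun i : ℕ => p m i ∈ Set.Ioo u v).card : ℝ) := by
      rw [Finset.card_filter, Nat.cast_sum]
      refine Finset.sum_le_sum fun i hi => ?_
      rw [(hψg _ (hp m i hi) g hg hg0).1, Complex.ofReal_re]
      split_ifs with h
      · simpa using hg1 _
      · simpa using hgv _ h
    calc (m + 1 : ℝ)⁻¹ * ∑ i ∈ Finset.range (m + 1), (ψ (p m i) (cfcₙ g a)).re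
        ≤ (m + 1 : ℝ)⁻¹ * ((v - u) / (t - s) * (m + 1) + 1) :=
          mul_le_mul_of_nonneg_left (h1.trans (card_filter_Ioo_le hst huv m)) (hm0 m).le
      _ = (v - u) / (t - s) + (m + 1 : ℝ)⁻¹ := by
          rw [mul_add, mul_one, mul_left_comm, hm1, mul_one]

end Diffuse

section NoInterval

lemma continuous_sum_apply {ι : Type*} {S : Finset ι} {g : ι → ℝ → ℝ} (hg : ∀ i, Continuous (g i)) :
    Continuous (∑ i ∈ S, g i) := by
  rw [show (∑ i ∈ S, g i) = fun x => ∑ i ∈ S, g i x from funext fun x => Finset.sum_apply x S g]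
  exact continuous_finsetSum _ fun i _ => hg i

/-- The truncation of a real number to `[0, 1]`. -/
noncomputable def clampUnit (z : ℝ) : ℝ := max 0 (min 1 z)

lemma continuous_clampUnit : Continuous clampUnit := by unfold clampUnit; fun_prop

lemma clampUnit_nonneg (z : ℝ) : 0 ≤ clampUnit z := le_max_left _ _

lemma clampUnit_le_one (z : ℝ) : clampUnit z ≤ 1 := max_le zero_le_one (min_le_left _ _)

lemma clampUnit_of_nonpos {z : ℝ} (hz : z ≤ 0) : clampUnit z = 0 :=
  max_eq_left ((min_le_right _ _).trans hz)

lemma clampUnit_of_one_le {z : ℝ} (hz : 1 ≤ z) : clampUnit z = 1 := by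
  rw [clampUnit, min_eq_left hz, max_eq_right zero_le_one]

lemma clampUnit_mono : Monotone clampUnit := fun _ _ h => max_le_max le_rfl (min_le_min le_rfl h)

/-- A trapezoidal bump function supported in `[j, j + 2]`. -/
noncomputable def tent (j : ℕ) (y : ℝ) : ℝ := clampUnit (y - j) - clampUnit (y - (j + 1 : ℕ))

lemma continuous_tent (j : ℕ) : Continuous (tent j) := by
  have := continuous_clampUnit
  unfold tent; fun_prop

lemma tent_nonneg (j : ℕ) (y : ℝ) : 0 ≤ tent j y :=
  sub_nonneg.mpr (clampUnit_mono (by push_cast; linarith))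

lemma tent_le_one (j : ℕ) (y : ℝ) : tent j y ≤ 1 :=
  (sub_le_self _ (clampUnit_nonneg _)).trans (clampUnit_le_one _)

lemma tent_eq_zero {j : ℕ} {y : ℝ} (hy : y ∉ Set.Ioo (j : ℝ) (j + 2)) : tent j y = 0 := by
  rw [Set.mem_Ioo, not_and_or, not_lt, not_lt] at hy
  unfold tent
  rcases hy with h | h
  · rw [clampUnit_of_nonpos (by linarith), clampUnit_of_nonpos (by push_cast; linarith), sub_zero]
  · rw [clampUnit_of_one_le (by linarith), clampUnit_of_one_le (by push_cast; linarith), sub_self]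

lemma sum_tent {N : ℕ} {y : ℝ} (hy : y ∈ Set.Icc (1 : ℝ) (N + 1)) :
    ∑ j ∈ Finset.range (N + 1), tent j y = 1 := by
  unfold tent
  rw [Finset.sum_range_sub' (fun j : ℕ => clampUnit (y - j)),
    clampUnit_of_one_le (by simpa using hy.1),
    clampUnit_of_nonpos (by push_cast; linarith [hy.2]), sub_zero]

/-- At most two tents are nonzero at a given point, so the bound survives taking roots. -/
lemma sum_sqrt_tent_le (N : ℕ) (y : ℝ) : ∑ j ∈ Finset.range N, √(tent j y) ≤ 2 := by
  classical
  have h1 : ∑ j ∈ Finset.range N, √(tent j y) ≤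
      (((Finset.range N).filter fun j : ℕ => y ∈ Set.Ioo (j : ℝ) (j + 2)).card : ℝ) := by
    rw [Finset.card_filter, Nat.cast_sum]
    refine Finset.sum_le_sum fun j _ => ?_
    split_ifs with h
    · simpa using tent_le_one j y
    · simp [tent_eq_zero h]
  refine h1.trans ?_
  have h2 : ((Finset.range N).filter fun j : ℕ => y ∈ Set.Ioo (j : ℝ) (j + 2)).card ≤ 2 := by
    by_contra! h
    obtain ⟨i, j, k, hi, hj, hk, hij, hik, hjk⟩ := Finset.two_lt_card_iff.mp h
    simp only [Finset.mem_filter, Set.mem_Ioo] at hi hj hk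
    have key : ∀ p q : ℕ, (p : ℝ) < y → y < q + 2 → p < q + 2 := fun p q h1 h2 => by
      exact_mod_cast h1.trans h2
    have := key i j hi.2.1 hj.2.2
    have := key i k hi.2.1 hk.2.2
    have := key j i hj.2.1 hi.2.2
    have := key j k hj.2.1 hk.2.2
    have := key k i hk.2.1 hi.2.2
    have := key k j hk.2.1 hj.2.2
    omega
  exact_mod_cast h2

variable {A : Type*} [NonUnitalCStarAlgebra A]

set_option maxHeartbeats 1600000 in
/-- If nonzero positive functionals dominate pure ones, then the spectrum of a self-adjoint element
contains no interval. -/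
theorem DominatesPure.not_Icc_subset (hA : DominatesPure A) {a : A} (ha : IsSelfAdjoint a)
    {s t : ℝ} (hs : 0 < s) (hst : s < t) : ¬ Set.Icc s t ⊆ quasispectrum ℝ a := by
  intro hsp
  obtain ⟨f, hfp, hf⟩ := exists_diffuse_functional ha hst hsp
  have hd : 0 < t - s := sub_pos.mpr hst
  -- `κ` vanishes at `0` and is `1` on `[s, t]`, so `k` acts as a unit for `f`.
  let κ : ℝ → ℝ := fun x => clampUnit (x / s)
  have hκ : Continuous κ := continuous_clampUnit.comp (by fun_prop)
  have hκ0 : κ 0 = 0 := clampUnit_of_nonpos (by simp)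
  have hκ1 : ∀ r ∈ Set.Icc s t, κ r = 1 := fun r hr =>
    clampUnit_of_one_le ((one_le_div hs).mpr hr.1)
  set k := cfcₙ κ a with hk
  have hksa : IsSelfAdjoint k := IsSelfAdjoint.cfcₙ
  obtain ⟨-, h2, -, -⟩ := hf κ hκ hκ0
  obtain ⟨hfk, hfxk⟩ := h2 hκ1
  obtain ⟨h, hh, hle⟩ := hA f hfp (by rintro rfl; simp at hfk)
  have hbound : ∀ N : ℕ, 1 ≤ N → t - s ≤ s * N → (h (k * k)).re ≤ 2 * (2 / N) := by
    intro N hN1 hN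
    have hN0 : (0 : ℝ) < N := by exact_mod_cast hN1
    -- `y` carries `[s, t]` to `[1, N + 1]`, where the tents sum to `1`. The condition `t - s ≤ s N`
    -- puts `y 0` at or below `0`, so all tents vanish at `0`.
    let y : ℝ → ℝ := fun x => (x - s) * (N / (t - s)) + 1
    have hy : Continuous y := by fun_prop
    have hy0 : y 0 ≤ 0 := by
      have : 1 ≤ s * (N / (t - s)) := by
        rw [mul_div_assoc', one_le_div hd]; exact hN
      simp only [y]; linarith
    have hτ0 : ∀ j, tent j (y 0) = 0 := fun j => tent_eq_zero fun h => by
      have : (0 : ℝ) ≤ j := by positivity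
      linarith [h.1]
    have hyst : ∀ r ∈ Set.Icc s t, y r ∈ Set.Icc (1 : ℝ) (N + 1) := fun r hr => by
      have h1 : 0 ≤ (r - s) * (N / (t - s)) :=
        mul_nonneg (sub_nonneg.mpr hr.1) (by positivity)
      have h2 : (r - s) * (N / (t - s)) ≤ N := by
        calc (r - s) * (N / (t - s)) ≤ (t - s) * (N / (t - s)) := by
              have := hr.2; gcongr
          _ = N := by field_simp
      constructor <;> simp only [y] <;> linarith
    let τ : ℕ → ℝ → ℝ := fun j x => tent j (y x)
    have hτ : ∀ j, Continuous (τ j) := fun j => (continuous_tent j).comp hy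
    let σ : ℕ → ℝ → ℝ := fun j x => √(τ j x)
    have hσ : ∀ j, Continuous (σ j) := fun j => (hτ j).sqrt
    have hσ0 : ∀ j, σ j 0 = 0 := fun j => by simp [σ, τ, hτ0]
    have hσ1 : ∀ j x, σ j x ≤ 1 := fun j x => by
      simpa [σ] using tent_le_one j (y x)
    -- Fourth roots of the tents: the fourth powers sum to `1` on `[s, t]`, while the squares `σ j`
    -- still sum to at most `2`.
    let δ : ℕ → ℝ → ℝ := fun j x => √(σ j x)
    have hδ : ∀ j, Continuous (δ j) := fun j => (hσ j).sqrt
    have hδ0 : ∀ j, δ j 0 = 0 := fun j => by simp [δ, hσ0]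
    have hdd : ∀ j, cfcₙ (δ j) a * cfcₙ (δ j) a = cfcₙ (σ j) a := fun j => by
      rw [← cfcₙ_mul (δ j) (δ j) a (hδ j).continuousOn (hδ0 j) (hδ j).continuousOn (hδ0 j)]
      exact cfcₙ_congr fun x _ => Real.mul_self_sqrt (Real.sqrt_nonneg _)
    have hσσ : ∀ j, cfcₙ (σ j) a * cfcₙ (σ j) a = cfcₙ (τ j) a := fun j => by
      rw [← cfcₙ_mul (σ j) (σ j) a (hσ j).continuousOn (hσ0 j) (hσ j).continuousOn (hσ0 j)]
      exact cfcₙ_congr fun x _ => Real.mul_self_sqrt (tent_nonneg _ _)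
    refine hh.apply_sq_le hfp hle (Finset.range (N + 1)) (fun j => cfcₙ (δ j) a)
      (fun j => IsSelfAdjoint.cfcₙ) (fun j => (hf (δ j) (hδ j) (hδ0 j)).1) (fun x => ?_)
      (fun j x => ?_) (fun x => ?_) hksa (fun j => cfcₙ_commute_cfcₙ _ _ _) (by positivity)
      (fun j => ?_)
    · simp only [hdd]
      rw [← Complex.re_sum, ← map_sum, ← Finset.mul_sum,
        ← cfcₙ_sum σ a _ (fun j _ => (hσ j).continuousOn) (fun j _ => hσ0 j)]
      refine (hf _ (continuous_sum_apply hσ) (by simp [hσ0])).2.2.1 2 (fun r => ?_) x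
      rw [Finset.sum_apply]
      exact sum_sqrt_tent_le _ _
    · rw [hdd]
      exact (hf _ (hσ j) (hσ0 j)).2.2.1 2 (fun r => (hσ1 j r).trans one_le_two) x
    · simp only [hdd, hσσ]
      rw [← cfcₙ_sum τ a _ (fun j _ => (hτ j).continuousOn) (fun j _ => hτ0 j)]
      refine ((hf _ (continuous_sum_apply hτ) (by simp [τ, hτ0])).2.1 fun r hr => ?_).2 x
      rw [Finset.sum_apply]
      exact sum_tent (hyst r hr)
    · rw [hdd, hk, ← cfcₙ_mul κ κ a hκ.continuousOn hκ0 hκ.continuousOn hκ0,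
        ← cfcₙ_mul (fun x => κ x * κ x) (σ j) a (hκ.mul hκ).continuousOn (by simp [hκ0])
        (hσ j).continuousOn (hσ0 j)]
      -- The tent `j` is supported where `y` lies in `(j, j + 2)`, an interval of length `2 (t - s)
      -- / N`, so its mass is at most `2 / N`.
      have := (hf (fun x => κ x * κ x * σ j x) ((hκ.mul hκ).mul (hσ j)) (by simp [hσ0])).2.2.2
        (s + (j - 1) * ((t - s) / N)) (s + (j + 1) * ((t - s) / N))
        (by gcongr; linarith) (fun r => ?_) (fun r hr => le_of_eq ?_)
      · refine this.trans (le_of_eq ?_)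
        field_simp
        ring
      · have h1 := clampUnit_nonneg (r / s)
        have h2 := clampUnit_le_one (r / s)
        exact mul_le_one₀ (mul_le_one₀ h2 h1 h2) (Real.sqrt_nonneg _) (hσ1 j r)
      · have : τ j r = 0 := tent_eq_zero fun h => hr ?_
        · simp [σ, this]
        · obtain ⟨h1, h2⟩ := h
          simp only [y] at h1 h2
          have e : (r - s) = (r - s) * (N / (t - s)) * ((t - s) / N) := by field_simp
          have hq : 0 < (t - s) / N := by positivity
          constructor
          · have : (j - 1) * ((t - s) / N) < (r - s) * (N / (t - s)) * ((t - s) / N) := by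
              gcongr; linarith
            linarith
          · have : (r - s) * (N / (t - s)) * ((t - s) / N) < (j + 1) * ((t - s) / N) := by
              gcongr; linarith
            linarith
  have hkk : (h (k * k)).re ≤ 0 := by
    have hlim : Filter.Tendsto (fun N : ℕ => 2 * (2 / (N : ℝ))) Filter.atTop (nhds (2 * 0)) :=
      (tendsto_const_div_atTop_nhds_zero_nat 2).const_mul 2
    rw [mul_zero] at hlim
    obtain ⟨N₀, hN₀⟩ := exists_nat_ge ((t - s) / s)
    refine ge_of_tendsto hlim ?_
    filter_upwards [Filter.eventually_ge_atTop (max 1 N₀)] with N hN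
    refine hbound N ((le_max_left _ _).trans hN) ?_
    rw [div_le_iff₀' hs] at hN₀
    refine hN₀.trans ?_
    have : (N₀ : ℝ) ≤ N := by exact_mod_cast (le_max_right _ _).trans hN
    gcongr
  obtain ⟨K, _, _, _, Λ', π', η, hg⟩ := hh.positive.exists_isGNS
  have hΛk : Λ' k = 0 := by
    rw [← norm_eq_zero, ← sq_eq_zero_iff]
    refine le_antisymm ?_ (sq_nonneg _)
    rw [hg.norm_sq, hksa.star_eq]
    exact hkk
  refine hh.ne_zero (hh.positive.eq_zero_of_star_mul_self fun x => ?_)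
  have h1 : Λ' (x * k) = 0 := by rw [hg.map_mul, hΛk, map_zero]
  -- `x k - x` is null for `f`, hence for `h`; as `x k` is null too, `Λ'` vanishes.
  have h2 : Λ' (x * k - x) = 0 := by
    rw [← norm_eq_zero, ← sq_eq_zero_iff]
    refine le_antisymm ?_ (sq_nonneg _)
    rw [hg.norm_sq]
    have h3 := (hle (x * k - x)).1
    rw [sub_apply, Complex.sub_re, Complex.zero_re, sub_nonneg] at h3
    refine h3.trans (le_of_eq ?_)
    rw [mul_sub, ← mul_assoc, map_sub, hfxk, sub_self, Complex.zero_re]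
  rw [map_sub, h1, zero_sub, neg_eq_zero] at h2
  rw [← hg.inner_apply, h2, inner_zero_left]

end NoInterval

/-! ### Minimal projections -/

section MinimalProjection

variable {D : Type*} [NonUnitalCStarAlgebra D]

lemma eq_zero_of_cfcₙ_eq_zero {a : D} (ha : IsSelfAdjoint a) {g : ℝ → ℝ}
    (hg : ContinuousOn g (quasispectrum ℝ a)) (hg0 : g 0 = 0) (h : cfcₙ g a = 0) {x : ℝ}
    (hx : x ∈ quasispectrum ℝ a) : g x = 0 := by
  refine eqOn_of_cfcₙ_eq_cfcₙ (a := a) (f := g) (g := fun _ => 0) ?_ ha hg hg0 (by fun_prop) rfl hx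
  rw [h]; simp [cfcₙ_const_zero]

lemma mul_cfcₙ_self {a : D} (ha : IsSelfAdjoint a) {g : ℝ → ℝ}
    (hg : ContinuousOn g (quasispectrum ℝ a)) (hg0 : g 0 = 0) :
    a * cfcₙ g a = cfcₙ (fun x => x * g x) a := by
  rw [cfcₙ_mul (fun x => x) g a continuousOn_id rfl hg hg0, cfcₙ_id' ℝ a ha]

lemma cfcₙ_mul_self {a : D} (ha : IsSelfAdjoint a) {g : ℝ → ℝ}
    (hg : ContinuousOn g (quasispectrum ℝ a)) (hg0 : g 0 = 0) :
    cfcₙ g a * a = cfcₙ (fun x => g x * x) a := by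
  rw [cfcₙ_mul g (fun x => x) a hg hg0 continuousOn_id rfl, cfcₙ_id' ℝ a ha]

/-- The spectral projection above a point outside the spectrum. -/
noncomputable def gapProjection (a : D) (r : ℝ) : D :=
  cfcₙ (fun x => if r < x then 1 else 0 : ℝ → ℝ) a

section Gap

variable {a p : D} {r : ℝ}

lemma continuousOn_ite_lt {S : Set ℝ} {g : ℝ → ℝ} (hr : r ∉ S)
    (hg : ∀ x ∈ S, r < x → ContinuousWithinAt g S x) :
    ContinuousOn (fun x => if r < x then g x else 0) S := by
  intro x hx
  rcases lt_trichotomy x r with h | rfl | h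
  · refine ContinuousWithinAt.congr_of_eventuallyEq (f := fun _ => 0) continuousWithinAt_const ?_
      (if_neg h.not_gt)
    filter_upwards [mem_nhdsWithin_of_mem_nhds (Iio_mem_nhds h)] with y hy
    exact if_neg (not_lt_of_gt hy)
  · exact absurd hx hr
  · refine (hg x hx h).congr_of_eventuallyEq ?_ (if_pos h)
    filter_upwards [mem_nhdsWithin_of_mem_nhds (Ioi_mem_nhds h)] with y hy
    exact if_pos hy

lemma isStarProjection_gapProjection (hr0 : 0 < r) (hr : r ∉ quasispectrum ℝ a) :
    IsStarProjection (gapProjection a r) := by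
  have hc := continuousOn_ite_lt (g := fun _ => 1) hr fun _ _ _ => continuousWithinAt_const
  have h0 : (if r < 0 then 1 else 0 : ℝ) = 0 := if_neg hr0.not_gt
  refine ⟨?_, IsSelfAdjoint.cfcₙ⟩
  rw [IsIdempotentElem, gapProjection, ← cfcₙ_mul _ _ a hc h0 hc h0]
  exact cfcₙ_congr fun x _ => by split_ifs <;> simp

lemma gapProjection_mul_self (ha : IsSelfAdjoint a) (hr0 : 0 < r) (hr : r ∉ quasispectrum ℝ a) :
    gapProjection a r * a = cfcₙ (fun x => if r < x then x else 0 : ℝ → ℝ) a := by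
  have hc := continuousOn_ite_lt (g := fun _ => 1) hr fun _ _ _ => continuousWithinAt_const
  have h0 : (if r < 0 then 1 else 0 : ℝ) = 0 := if_neg hr0.not_gt
  rw [gapProjection, cfcₙ_mul_self ha hc h0]
  exact cfcₙ_congr fun x _ => by split_ifs <;> simp

/-- The gap projection is `a` times the truncated inverse, so it lies in the right ideal generated
by `a`. -/
lemma mul_gapProjection (ha : IsSelfAdjoint a) (hr0 : 0 < r) (hr : r ∉ quasispectrum ℝ a)
    (hpa : p * a = a) : p * gapProjection a r = gapProjection a r := by
  have hc := continuousOn_ite_lt (g := fun x => x⁻¹) hr fun x _ h =>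
    (continuousAt_inv₀ (hr0.trans h).ne').continuousWithinAt
  have h0 : (if r < 0 then 0⁻¹ else 0 : ℝ) = 0 := if_neg hr0.not_gt
  have : gapProjection a r = a * cfcₙ (fun x => if r < x then x⁻¹ else 0 : ℝ → ℝ) a := by
    rw [mul_cfcₙ_self ha hc h0]
    refine cfcₙ_congr fun x _ => ?_
    split_ifs with h
    · exact (mul_inv_cancel₀ (hr0.trans h).ne').symm
    · exact (mul_zero x).symm
  rw [this, ← mul_assoc, hpa]

lemma gapProjection_ne_zero (ha : IsSelfAdjoint a) (hr0 : 0 < r) (hr : r ∉ quasispectrum ℝ a)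
    {t : ℝ} (ht : t ∈ quasispectrum ℝ a) (hrt : r < t) : gapProjection a r ≠ 0 := by
  have hc := continuousOn_ite_lt (g := fun _ => 1) hr fun _ _ _ => continuousWithinAt_const
  intro h
  have := eq_zero_of_cfcₙ_eq_zero ha hc (if_neg hr0.not_gt) h ht
  simp [hrt] at this

lemma gapProjection_ne (ha : IsSelfAdjoint a) (hr0 : 0 < r) (hr : r ∉ quasispectrum ℝ a)
    (hpa : p * a = a) {s : ℝ} (hs : s ∈ quasispectrum ℝ a) (hsr : s < r) (hs0 : s ≠ 0) :
    gapProjection a r ≠ p := by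
  rintro rfl
  rw [gapProjection_mul_self ha hr0 hr] at hpa
  have hc := continuousOn_ite_lt (g := fun x => x) hr fun _ _ _ => continuousWithinAt_id
  have := eqOn_of_cfcₙ_eq_cfcₙ (a := a) (g := fun x => x) (hpa.trans (cfcₙ_id' ℝ a ha).symm) ha hc
    (if_neg hr0.not_gt) continuousOn_id rfl hs
  simp [hsr.not_gt] at this
  exact hs0 this.symm

end Gap

lemma IsStarProjection.norm_eq_one_of_ne_zero {p : D} (hp : IsStarProjection p) (h0 : p ≠ 0) :
    ‖p‖ = 1 := by
  have h := CStarRing.norm_star_mul_self (x := p)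
  rw [hp.isSelfAdjoint.star_eq, hp.isIdempotentElem] at h
  have : ‖p‖ ≠ 0 := norm_ne_zero_iff.mpr h0
  field_simp at h
  linarith

variable (D) in
/-- No positive interval is contained in the spectrum of a self-adjoint element. -/
def NoSpectralInterval : Prop :=
  ∀ a : D, IsSelfAdjoint a → ∀ s t : ℝ, 0 < s → s < t → ¬ Set.Icc s t ⊆ quasispectrum ℝ a

/-- Using the middle third keeps the left endpoint positive even when `s = 0`. -/
lemma NoSpectralInterval.exists_notMem (H : NoSpectralInterval D) {a : D} (ha : IsSelfAdjoint a)
    {s t : ℝ} (hs : 0 ≤ s) (hst : s < t) : ∃ r, s < r ∧ r < t ∧ r ∉ quasispectrum ℝ a := by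
  have := H a ha (s + (t - s) / 3) (s + 2 * (t - s) / 3) (by linarith) (by linarith)
  obtain ⟨r, hr, h⟩ := Set.not_subset.mp this
  exact ⟨r, by linarith [hr.1], by linarith [hr.2], h⟩

lemma IsSelfAdjoint.exists_mem_quasispectrum_ne_zero {a : D} (ha : IsSelfAdjoint a) (h0 : a ≠ 0) :
    ∃ t ∈ quasispectrum ℝ a, t ≠ 0 := by
  by_contra! h
  refine h0 ?_
  rw [← cfcₙ_id' ℝ a ha, cfcₙ_congr (g := fun _ => 0) (fun x hx => h x hx), cfcₙ_const_zero]

lemma IsSelfAdjoint.exists_pos_mem_quasispectrum {a : D} (ha : IsSelfAdjoint a) (h0 : a ≠ 0) :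
    ∃ b, (b = a ∨ b = -a) ∧ ∃ t ∈ quasispectrum ℝ b, 0 < t := by
  obtain ⟨t, ht, ht0⟩ := ha.exists_mem_quasispectrum_ne_zero h0
  rcases ht0.lt_or_gt with h | h
  · refine ⟨-a, Or.inr rfl, -t, ?_, by linarith⟩
    have := cfcₙ_map_quasispectrum (fun x : ℝ => -x) a (by fun_prop) (by simp) ha
    rw [cfcₙ_neg (fun x : ℝ => x), cfcₙ_id' ℝ a ha] at this
    rw [this]; exact ⟨t, ht, rfl⟩
  · exact ⟨a, Or.inl rfl, t, ht, h⟩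

lemma NoSpectralInterval.exists_isStarProjection (H : NoSpectralInterval D) {a : D} (h0 : a ≠ 0) :
    ∃ p : D, IsStarProjection p ∧ p ≠ 0 := by
  obtain ⟨b, hb, t, ht, ht0⟩ := (IsSelfAdjoint.star_mul_self a).exists_pos_mem_quasispectrum
    (CStarRing.star_mul_self_eq_zero_iff a |>.not.mpr h0)
  have hb : IsSelfAdjoint b := by
    rcases hb with rfl | rfl
    exacts [.star_mul_self a, (IsSelfAdjoint.star_mul_self a).neg]
  obtain ⟨r, hr0, hrt, hr⟩ := H.exists_notMem hb le_rfl ht0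
  exact ⟨_, isStarProjection_gapProjection hr0 hr, gapProjection_ne_zero hb hr0 hr ht hrt⟩

/-- A nonzero projection is minimal or dominates a strictly smaller nonzero projection. -/
lemma NoSpectralInterval.exists_lt (H : NoSpectralInterval D) {p : D} (hp : IsStarProjection p)
    (hmin : ¬ ∀ x, ∃ c : ℂ, p * x * p = c • p) :
    ∃ q : D, IsStarProjection q ∧ q ≠ 0 ∧ q ≠ p ∧ p * q = q := by
  obtain ⟨y, hy, hpy, hyp⟩ : ∃ y : D, IsSelfAdjoint y ∧ p * y = y ∧ ∀ c : ℂ, y ≠ c • p := by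
    have key : ¬ ∀ x : D, IsSelfAdjoint x → ∃ c : ℂ, p * x * p = c • p := fun h => hmin fun x => by
      obtain ⟨c, hc⟩ := h (realPart x) (realPart x).2
      obtain ⟨d, hd⟩ := h (imaginaryPart x) (imaginaryPart x).2
      refine ⟨c + Complex.I * d, ?_⟩
      conv_lhs => rw [← realPart_add_I_smul_imaginaryPart x]
      rw [mul_add, add_mul, hc, mul_smul_comm, smul_mul_assoc, hd, add_smul, mul_smul]
    push Not at key
    obtain ⟨x, hx, h⟩ := key
    refine ⟨p * x * p, ?_, ?_, h⟩
    · have := hx.conjugate p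
      rwa [hp.isSelfAdjoint.star_eq] at this
    · rw [← mul_assoc, ← mul_assoc, hp.isIdempotentElem]
  have hy0 : y ≠ 0 := fun h => hyp 0 (by rw [h, zero_smul])
  obtain ⟨b, hb, t, ht, ht0⟩ := hy.exists_pos_mem_quasispectrum hy0
  obtain ⟨hbsa, hpb, hbp⟩ : IsSelfAdjoint b ∧ p * b = b ∧ ∀ c : ℂ, b ≠ c • p := by
    rcases hb with rfl | rfl
    · exact ⟨hy, hpy, hyp⟩
    · refine ⟨hy.neg, by rw [mul_neg, hpy], fun c hc => hyp (-c) ?_⟩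
      rw [neg_smul, ← hc, neg_neg]
  by_contra! hno
  have hq : ∀ r, 0 < r → r ∉ quasispectrum ℝ b → ∀ t ∈ quasispectrum ℝ b, r < t →
      gapProjection b r = p := fun r hr0 hr t ht hrt => by
    by_contra hne
    exact hno _ (isStarProjection_gapProjection hr0 hr) (gapProjection_ne_zero hbsa hr0 hr ht hrt)
      hne (mul_gapProjection hbsa hr0 hr hpb)
  -- Two distinct nonzero spectral points, the larger one positive, are separated by a positive gap
  -- whose projection cannot be `p`. With a single nonzero point left, `b = t p`.
  have hone : ∀ s ∈ quasispectrum ℝ b, s ≠ 0 → s = t := fun s hs hs0 => by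
    rcases lt_trichotomy s t with h | h | h
    · obtain ⟨r, hr1, hr2, hr⟩ := H.exists_notMem hbsa (le_max_right s 0) (max_lt h ht0)
      have hr0 := (le_max_right s 0).trans_lt hr1
      exact absurd (hq r hr0 hr t ht hr2)
        (gapProjection_ne hbsa hr0 hr hpb hs ((le_max_left s 0).trans_lt hr1) hs0)
    · exact h
    · obtain ⟨r, hr1, hr2, hr⟩ := H.exists_notMem hbsa ht0.le h
      exact absurd (hq r (ht0.trans hr1) hr s hs hr2)
        (gapProjection_ne hbsa (ht0.trans hr1) hr hpb ht hr1 ht0.ne')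
  obtain ⟨r, hr0, hrt, hr⟩ := H.exists_notMem hbsa le_rfl ht0
  refine hbp t ?_
  have hc := continuousOn_ite_lt (g := fun _ => 1) hr fun _ _ _ => continuousWithinAt_const
  rw [← hq r hr0 hr t ht hrt, gapProjection, Complex.coe_smul,
    ← cfcₙ_smul t _ b hc (if_neg hr0.not_gt)]
  conv_lhs => rw [← cfcₙ_id' ℝ b hbsa]
  refine cfcₙ_congr fun x hx => ?_
  by_cases hx0 : x = 0
  · simp [hx0, hr0.not_gt]
  · simp [hone x hx hx0, hrt]

/-- A system of splittings of nonzero projections into two nonzero projections. -/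
structure ProjectionSplitting (P : Type*) (e : P → D) where
  left : P → P
  right : P → P
  isStarProjection : ∀ p, IsStarProjection (e p)
  ne_zero : ∀ p, e p ≠ 0
  left_add_right : ∀ p, e (left p) + e (right p) = e p
  left_mul_right : ∀ p, e (left p) * e (right p) = 0

namespace ProjectionSplitting

attribute [local instance] CStarAlgebra.spectralOrder CStarAlgebra.spectralOrderedRing

variable {P : Type*} {e : P → D} (S : ProjectionSplitting P e)

include S in
lemma mul_self (p : P) : e p * e p = e p := (S.isStarProjection p).isIdempotentElem

include S in
lemma nonneg (p : P) : 0 ≤ e p := by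
  rw [← S.mul_self p]
  nth_rw 1 [← (S.isStarProjection p).isSelfAdjoint.star_eq]
  exact star_mul_self_nonneg _

lemma right_mul_left (p : P) : e (S.right p) * e (S.left p) = 0 := by
  have := congrArg star (S.left_mul_right p)
  rwa [star_mul, (S.isStarProjection _).isSelfAdjoint.star_eq,
    (S.isStarProjection _).isSelfAdjoint.star_eq, star_zero] at this

lemma mul_left (p : P) : e p * e (S.left p) = e (S.left p) := by
  rw [← S.left_add_right, add_mul, S.right_mul_left, S.mul_self, add_zero]

lemma mul_right (p : P) : e p * e (S.right p) = e (S.right p) := by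
  rw [← S.left_add_right, add_mul, S.left_mul_right, S.mul_self, zero_add]

/-- Dyadic approximations of an element of spectrum `[0, 1]`. -/
noncomputable def approx : ℕ → P → D
  | 0, _ => 0
  | n + 1, p => (2⁻¹ : ℝ) • (e (S.left p) + (approx n (S.left p) + approx n (S.right p)))

lemma approx_succ (n : ℕ) (p : P) : S.approx (n + 1) p =
    (2⁻¹ : ℝ) • (e (S.left p) + (S.approx n (S.left p) + S.approx n (S.right p))) := rfl

/-- The increment at `p` is half the sum of the increments at its two pieces, whose projections add
up to `e p`. -/
lemma approx_succ_sub (n : ℕ) (p : P) : 0 ≤ S.approx (n + 1) p - S.approx n p ∧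
    S.approx (n + 1) p - S.approx n p ≤ ((2⁻¹ : ℝ) ^ (n + 1)) • e p := by
  induction n generalizing p with
  | zero =>
    simp only [approx, add_zero, sub_zero, zero_add, pow_one]
    refine ⟨smul_nonneg (by norm_num) (S.nonneg _), smul_le_smul_of_nonneg_left ?_ (by norm_num)⟩
    rw [← S.left_add_right p]
    exact le_add_of_nonneg_right (S.nonneg _)
  | succ n ih =>
    have key : S.approx (n + 1 + 1) p - S.approx (n + 1) p = (2⁻¹ : ℝ) •
        ((S.approx (n + 1) (S.left p) - S.approx n (S.left p)) +
          (S.approx (n + 1) (S.right p) - S.approx n (S.right p))) := by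
      rw [S.approx_succ (n + 1), S.approx_succ n p, ← smul_sub]
      congr 1
      abel
    rw [key, ← S.left_add_right p, pow_succ' _ (n + 1), mul_smul, smul_add _ (e _)]
    exact ⟨smul_nonneg (by norm_num) (add_nonneg (ih _).1 (ih _).1),
      smul_le_smul_of_nonneg_left (add_le_add (ih _).2 (ih _).2) (by norm_num)⟩

lemma approx_isSelfAdjoint_mul (n : ℕ) (p : P) :
    IsSelfAdjoint (S.approx n p) ∧ S.approx n p * e p = S.approx n p := by
  induction n generalizing p with
  | zero => simp [approx]
  | succ n ih =>
    have h1 : ∀ q : P, ∀ x : D, x * e q = x → e q * e p = e q → x * e p = x := fun q x h h' => by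
      rw [← h, mul_assoc, h']
    have hl : e (S.left p) * e p = e (S.left p) := by
      rw [← S.left_add_right p, mul_add, S.left_mul_right, S.mul_self, add_zero]
    have hr : e (S.right p) * e p = e (S.right p) := by
      rw [← S.left_add_right p, mul_add, S.right_mul_left, S.mul_self, zero_add]
    constructor
    · exact (IsSelfAdjoint.all (2⁻¹ : ℝ)).smul
        ((S.isStarProjection _).isSelfAdjoint.add ((ih _).1.add (ih _).1))
    · rw [approx, smul_mul_assoc, add_mul, add_mul, hl, h1 _ _ (ih _).2 hl, h1 _ _ (ih _).2 hr]

lemma exists_limit (p : P) : ∃ a, Filter.Tendsto (fun n => S.approx n p) Filter.atTop (nhds a) ∧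
    ‖a‖ ≤ 1 := by
  have h : ∀ n, dist (S.approx n p) (S.approx (n + 1) p) ≤ 1 / 2 / 2 ^ n := fun n => by
    obtain ⟨h1, h2⟩ := S.approx_succ_sub n p
    have := CStarAlgebra.norm_le_norm_of_nonneg_of_le h1 h2
    rw [norm_smul, (S.isStarProjection p).norm_eq_one_of_ne_zero (S.ne_zero p), mul_one] at this
    rw [dist_comm, dist_eq_norm]
    refine this.trans (le_of_eq ?_)
    rw [norm_pow, pow_succ', Real.norm_of_nonneg (by norm_num), inv_pow]
    ring
  obtain ⟨a, ha⟩ := cauchySeq_tendsto_of_complete (cauchySeq_of_le_geometric_two h)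
  refine ⟨a, ha, ?_⟩
  have := dist_le_of_le_geometric_two_of_tendsto₀ h ha
  simpa [approx, dist_eq_norm] using this

/-- The limit of the dyadic approximations. -/
noncomputable def limit (p : P) : D := (S.exists_limit p).choose

lemma tendsto_limit (p : P) :
    Filter.Tendsto (fun n => S.approx n p) Filter.atTop (nhds (S.limit p)) :=
  (S.exists_limit p).choose_spec.1

lemma norm_limit_le (p : P) : ‖S.limit p‖ ≤ 1 := (S.exists_limit p).choose_spec.2

lemma limit_eq (p : P) : S.limit p =
    (2⁻¹ : ℝ) • (e (S.left p) + (S.limit (S.left p) + S.limit (S.right p))) :=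
  tendsto_nhds_unique ((S.tendsto_limit p).comp (Filter.tendsto_add_atTop_nat 1))
    (((tendsto_const_nhds.add ((S.tendsto_limit _).add (S.tendsto_limit _))).const_smul _))

lemma limit_isSelfAdjoint (p : P) : IsSelfAdjoint (S.limit p) :=
  tendsto_nhds_unique (S.tendsto_limit p).star
    ((S.tendsto_limit p).congr fun n => (S.approx_isSelfAdjoint_mul n p).1.star_eq.symm)

lemma limit_mul (p : P) : S.limit p * e p = S.limit p :=
  tendsto_nhds_unique ((S.tendsto_limit p).mul_const (e p))
    ((S.tendsto_limit p).congr fun n => ((S.approx_isSelfAdjoint_mul n p).2).symm)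

/-- Self-similarity: the limit acts as `(1 + x) / 2` on the left piece and as `x / 2` on the right
one, like the coordinate on the two halves of `[0, 1]`. -/
lemma limit_mul_left (p : P) : S.limit p * e (S.left p) =
    (2⁻¹ : ℝ) • (e (S.left p) + S.limit (S.left p)) := by
  rw [S.limit_eq, smul_mul_assoc, add_mul, add_mul, S.mul_self, S.limit_mul,
    ← S.limit_mul (S.right p), mul_assoc, S.right_mul_left, mul_zero, add_zero]

lemma limit_mul_right (p : P) : S.limit p * e (S.right p) = (2⁻¹ : ℝ) • S.limit (S.right p) := by
  rw [S.limit_eq, smul_mul_assoc, add_mul, add_mul, S.left_mul_right, S.limit_mul,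
    ← S.limit_mul (S.left p), mul_assoc, S.left_mul_right, mul_zero, zero_add, zero_add]

/-- Descend the tree along the binary digits of `t`, replacing `t` by `2 t` or `2 t - 1`; each step
halves the error, which starts at most `2`. -/
lemma exists_norm_limit_mul_sub_le (n : ℕ) (p : P) {t : ℝ} (ht : t ∈ Set.Icc (0 : ℝ) 1) :
    ∃ r : P, e p * e r = e r ∧ ‖S.limit p * e r - t • e r‖ ≤ 2 * 2⁻¹ ^ n := by
  have hone : ∀ p, ‖e p‖ = 1 := fun p =>
    (S.isStarProjection p).norm_eq_one_of_ne_zero (S.ne_zero p)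
  induction n generalizing p t with
  | zero =>
    refine ⟨p, S.mul_self p, ?_⟩
    rw [S.limit_mul]
    refine (norm_sub_le _ _).trans ?_
    rw [norm_smul, hone, mul_one, Real.norm_of_nonneg ht.1]
    linarith [S.norm_limit_le p, ht.2]
  | succ n ih =>
    rcases lt_or_ge t 2⁻¹ with h | h
    · obtain ⟨r, hr, hle⟩ := ih (S.right p) (t := 2 * t) ⟨by linarith [ht.1], by linarith⟩
      refine ⟨r, by rw [← hr, ← mul_assoc, S.mul_right], ?_⟩
      have : S.limit p * e r - t • e r =
          (2⁻¹ : ℝ) • (S.limit (S.right p) * e r - (2 * t) • e r) := by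
        conv_lhs => rw [← hr, ← mul_assoc, S.limit_mul_right, hr]
        rw [smul_sub, smul_smul, smul_mul_assoc]
        congr 2; ring
      rw [this, norm_smul, pow_succ]
      norm_num at hle ⊢
      linarith
    · obtain ⟨r, hr, hle⟩ := ih (S.left p) (t := 2 * t - 1) ⟨by linarith, by linarith [ht.2]⟩
      refine ⟨r, by rw [← hr, ← mul_assoc, S.mul_left], ?_⟩
      have : S.limit p * e r - t • e r =
          (2⁻¹ : ℝ) • (S.limit (S.left p) * e r - (2 * t - 1) • e r) := by
        conv_lhs => rw [← hr, ← mul_assoc, S.limit_mul_left, smul_mul_assoc, add_mul, hr]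
        rw [← sub_eq_zero]
        module
      rw [this, norm_smul, pow_succ]
      norm_num at hle ⊢
      linarith

/-- Otherwise `k = a (a - t)⁻¹` exists in the algebra, since `x / (x - t)` vanishes at `0`. From `k
(a - t) = a`, the approximate eigenprojections `e r` would have `‖t e r‖` tending to `0`, whereas it
equals `t`. -/
lemma mem_quasispectrum_limit (p : P) {t : ℝ} (ht0 : 0 < t) (ht1 : t ≤ 1) :
    t ∈ quasispectrum ℝ (S.limit p) := by
  by_contra hsp
  have ha := S.limit_isSelfAdjoint p
  set a := S.limit p with ha'
  have hc : ContinuousOn (fun x : ℝ => x / (x - t)) (quasispectrum ℝ a) := by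
    refine continuousOn_id.div (by fun_prop) fun x hx h => hsp ?_
    rwa [← sub_eq_zero.mp h]
  have h0 : (0 : ℝ) / (0 - t) = 0 := zero_div _
  set k := cfcₙ (fun x : ℝ => x / (x - t)) a with hk
  have hka : k * a = a + t • k := by
    rw [hk, cfcₙ_mul_self ha hc h0, ← cfcₙ_smul t _ a hc h0]
    conv_rhs => enter [1]; rw [← cfcₙ_id' ℝ a ha]
    rw [← cfcₙ_add (fun x => x) (fun x => t • (x / (x - t))) a continuousOn_id rfl (hc.const_smul t) (by simp)]
    refine cfcₙ_congr fun x hx => ?_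
    have : x - t ≠ 0 := fun h => hsp (by rwa [← sub_eq_zero.mp h])
    simp only [smul_eq_mul]
    field_simp
    ring
  have hbd : ∀ n : ℕ, t ≤ (‖k‖ + 1) * (2 * 2⁻¹ ^ n) := fun n => by
    obtain ⟨r, hr, hle⟩ := S.exists_norm_limit_mul_sub_le n p ⟨ht0.le, ht1⟩
    have h1 : a * e r = k * (a * e r - t • e r) := by
      rw [mul_sub, ← mul_assoc, hka, add_mul, mul_smul_comm, smul_mul_assoc, add_sub_cancel_right]
    have h2 : ‖a * e r‖ ≤ ‖k‖ * (2 * 2⁻¹ ^ n) := by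
      rw [h1]; exact (norm_mul_le _ _).trans (by gcongr)
    have h3 : t = ‖t • e r‖ := by
      rw [norm_smul, (S.isStarProjection r).norm_eq_one_of_ne_zero (S.ne_zero r), mul_one,
        Real.norm_of_nonneg ht0.le]
    have h4 : ‖t • e r‖ ≤ ‖a * e r‖ + ‖a * e r - t • e r‖ := by
      have := norm_sub_le (a * e r) (a * e r - t • e r)
      rwa [sub_sub_cancel] at this
    linarith
  have hlim : Filter.Tendsto (fun n : ℕ => (‖k‖ + 1) * (2 * (2⁻¹ : ℝ) ^ n)) Filter.atTop
      (nhds ((‖k‖ + 1) * (2 * 0))) :=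
    ((tendsto_pow_atTop_nhds_zero_of_lt_one (by norm_num) (by norm_num)).const_mul 2).const_mul _
  have := ge_of_tendsto' hlim hbd
  linarith

end ProjectionSplitting

/-- A nonzero C⋆-algebra without intervals in spectra contains a minimal projection. -/
theorem NoSpectralInterval.exists_minimal (H : NoSpectralInterval D) {a : D} (h0 : a ≠ 0) :
    ∃ p : D, IsStarProjection p ∧ p ≠ 0 ∧ ∀ x, ∃ c : ℂ, p * x * p = c • p := by
  by_contra! hno
  let P := {p : D // IsStarProjection p ∧ p ≠ 0}
  have hP : ∀ p : P, ∃ q : P, q.1 ≠ p.1 ∧ p.1 * q.1 = q.1 := fun p => by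
    obtain ⟨q, h1, h2, h3, h4⟩ := H.exists_lt p.2.1 fun h => by
      obtain ⟨x, hx⟩ := hno p.1 p.2.1 p.2.2
      obtain ⟨c, hc⟩ := h x
      exact hx c hc
    exact ⟨⟨q, h1, h2⟩, h3, h4⟩
  choose l hl1 hl2 using hP
  let S : ProjectionSplitting P (fun p => p.1) :=
    { left := l
      right := fun p => ⟨p.1 - (l p).1, (l p).2.1.sub_of_mul_eq_right p.2.1 (hl2 p),
        sub_ne_zero.mpr (hl1 p).symm⟩
      isStarProjection := fun p => p.2.1
      ne_zero := fun p => p.2.2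
      left_add_right := fun p => add_sub_cancel _ _
      left_mul_right := fun p => by
        have := congrArg star (hl2 p)
        rw [star_mul, (l p).2.1.isSelfAdjoint.star_eq, p.2.1.isSelfAdjoint.star_eq] at this
        simp only
        rw [mul_sub, this, (l p).2.1.isIdempotentElem, sub_self] }
  obtain ⟨p, hp⟩ := H.exists_isStarProjection h0
  exact H _ (S.limit_isSelfAdjoint ⟨p, hp⟩) (1 / 4) (1 / 2) (by norm_num) (by norm_num) fun t ht =>
    S.mem_quasispectrum_limit _ (by linarith [ht.1]) (by linarith [ht.2])

end MinimalProjection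

/-! ### Ranges of ⋆-homomorphisms and transfer of spectral properties -/

section ClosedRange

variable {A B : Type*} [NonUnitalCStarAlgebra A] [NonUnitalCStarAlgebra B]

lemma NonUnitalStarAlgHom.continuous_of_cstar (φ : A →⋆ₙₐ[ℂ] B) : Continuous φ :=
  AddMonoidHomClass.continuous_of_bound φ 1 fun a => by
    simpa using NonUnitalStarAlgHom.norm_apply_le φ a

/-- Truncating `a` at `±‖φ a‖` by functional calculus does not change its image. -/
lemma IsSelfAdjoint.exists_map_eq_norm_le (φ : A →⋆ₙₐ[ℂ] B) {a : A} (ha : IsSelfAdjoint a) :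
    ∃ a', φ a' = φ a ∧ ‖a'‖ ≤ ‖φ a‖ := by
  let g : ℝ → ℝ := fun x => max (-‖φ a‖) (min ‖φ a‖ x)
  have hg : Continuous g := by fun_prop
  have hg0 : g 0 = 0 := by simp [g]
  refine ⟨cfcₙ g a, ?_, norm_cfcₙ_le fun x _ => ?_⟩
  · rw [NonUnitalStarAlgHom.map_cfcₙ φ g a hg.continuousOn hg0 φ.continuous_of_cstar ha (ha.map φ)]
    conv_rhs => rw [← cfcₙ_id' ℝ (φ a) (ha.map φ)]
    refine cfcₙ_congr fun x hx => ?_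
    have := NonUnitalIsometricContinuousFunctionalCalculus.norm_quasispectrum_le (𝕜 := ℝ) (φ a) hx
      (ha.map φ)
    rw [Real.norm_eq_abs, abs_le] at this
    simp only [g]
    rw [min_eq_right this.2, max_eq_right this.1]
  · rw [Real.norm_eq_abs, abs_le]
    exact ⟨le_max_left _ _, max_le (by linarith [norm_nonneg (φ a)]) (min_le_left _ _)⟩

lemma NonUnitalStarAlgHom.exists_map_eq_norm_le (φ : A →⋆ₙₐ[ℂ] B) (a : A) :
    ∃ a', φ a' = φ a ∧ ‖a'‖ ≤ 2 * ‖φ a‖ := by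
  obtain ⟨b, hb, hb'⟩ := (realPart a).2.exists_map_eq_norm_le φ
  obtain ⟨c, hc, hc'⟩ := (imaginaryPart a).2.exists_map_eq_norm_le φ
  have h1 : ‖φ (realPart a : A)‖ ≤ ‖φ a‖ := by
    rw [map_realPart]; exact realPart.norm_le (φ a)
  have h2 : ‖φ (imaginaryPart a : A)‖ ≤ ‖φ a‖ := by
    rw [map_imaginaryPart]; exact imaginaryPart.norm_le (φ a)
  refine ⟨b + Complex.I • c, ?_, (norm_add_le _ _).trans ?_⟩
  · conv_rhs => rw [← realPart_add_I_smul_imaginaryPart a]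
    rw [map_add, map_smul, map_add, map_smul, hb, hc]
  · rw [norm_smul, Complex.norm_I]
    linarith

/-- The range of a ⋆-homomorphism between C⋆-algebras is closed. -/
theorem NonUnitalStarAlgHom.isClosed_range (φ : A →⋆ₙₐ[ℂ] B) :
    IsClosed (NonUnitalStarAlgHom.range φ : Set B) := by
  let F : NormedAddGroupHom A B := (φ : A →+ B).mkNormedAddGroupHom 1 fun a => by
    simpa using NonUnitalStarAlgHom.norm_apply_le φ a
  -- Lifts with controlled norm, together with completeness of `A`, make the range closed.
  have hF : F.SurjectiveOnWith F.range 2 := by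
    rintro _ ⟨a, rfl⟩
    exact φ.exists_map_eq_norm_le a
  have := controlled_closure_of_complete two_pos one_pos hF
  rw [NonUnitalStarAlgHom.coe_range]
  refine isClosed_of_closure_subset fun b hb => ?_
  obtain ⟨a, ha, -⟩ := this b hb
  exact ⟨a, ha⟩

lemma NoSpectralInterval.of_surjective (hA : NoSpectralInterval A) {φ : A →⋆ₙₐ[ℂ] B}
    (hφ : Function.Surjective φ) : NoSpectralInterval B := fun b hb s t hs hst hsub => by
  obtain ⟨a, rfl⟩ := hφ b
  have h : φ (realPart a : A) = φ a := by
    rw [map_realPart, hb.coe_realPart]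
  refine hA _ (realPart a).2 s t hs hst (hsub.trans ?_)
  rw [← h]
  exact NonUnitalAlgHom.quasispectrum_apply_subset' ℂ φ _

lemma NoSpectralInterval.of_injective (hB : NoSpectralInterval B) {φ : A →⋆ₙₐ[ℂ] B}
    (hφ : Function.Injective φ) : NoSpectralInterval A := fun a ha s t hs hst hsub => by
  refine hB _ (ha.map φ) s t hs hst fun r hr => ?_
  by_contra hsp
  have hr0 : 0 < r := hs.trans_le hr.1
  obtain ⟨ε, hε, hball⟩ := Metric.isOpen_iff.mp
    (quasispectrum.isCompact (𝕜 := ℝ) (φ a)).isClosed.isOpen_compl r hsp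
  -- A bump at `r` that misses the spectrum of `φ a`; the height `min r ε` also makes it vanish at
  -- `0`. Injectivity gives `g(a) = 0`, although `g r > 0`.
  let g : ℝ → ℝ := fun x => max 0 (min r ε - |x - r|)
  have hg : Continuous g := by fun_prop
  have hg0 : g 0 = 0 := by simp [g, abs_of_pos hr0]
  have h1 : φ (cfcₙ g a) = 0 := by
    rw [NonUnitalStarAlgHom.map_cfcₙ φ g a hg.continuousOn hg0 φ.continuous_of_cstar ha (ha.map φ),
      ← cfcₙ_const_zero ℝ (φ a)]
    refine cfcₙ_congr fun x hx => max_eq_left ?_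
    by_contra! h
    refine hball (Metric.mem_ball.mpr ?_) hx
    rw [Real.dist_eq]
    linarith [min_le_right r ε]
  have h2 := eq_zero_of_cfcₙ_eq_zero ha hg.continuousOn hg0
    (hφ (h1.trans (map_zero φ).symm)) (hsub hr)
  have h3 : 0 < min r ε := lt_min hr0 hε
  simp only [g, sub_self, abs_zero, sub_zero] at h2
  rw [max_eq_right h3.le] at h2
  exact h3.ne' h2

end ClosedRange

/-! ### Pure functionals from minimal projections -/

section MinimalVector

open scoped InnerProductSpace
open Filter Topology ContinuousLinearMap

universe u v

variable {A : Type u} [NonUnitalCStarAlgebra A] {H : Type v} [NormedAddCommGroup H]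
  [InnerProductSpace ℂ H] [CompleteSpace H] {f : A →L[ℂ] ℂ} {Λ : A →L[ℂ] H}
  {π : A →⋆ₙₐ[ℂ] (H →L[ℂ] H)} {ξ : H}

/-- The closed cyclic subspace generated by a vector. -/
noncomputable def cyclicSubspace (π : A →⋆ₙₐ[ℂ] (H →L[ℂ] H)) (η : H) : Submodule ℂ H :=
  (Submodule.map ((ContinuousLinearMap.apply ℂ H η).toLinearMap.comp
    ((π : A →ₙₐ[ℂ] (H →L[ℂ] H)) : A →ₗ[ℂ] (H →L[ℂ] H))) ⊤).topologicalClosure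

lemma cyclicSubspace_induction {π : A →⋆ₙₐ[ℂ] (H →L[ℂ] H)} {η : H} {p : H → Prop}
    (hp : IsClosed {v | p v}) (h : ∀ a, p (π a η)) {v : H} (hv : v ∈ cyclicSubspace π η) : p v := by
  refine closure_minimal (t := {v | p v}) ?_ hp hv
  rintro _ ⟨a, -, rfl⟩
  exact h a

lemma apply_mem_cyclicSubspace (π : A →⋆ₙₐ[ℂ] (H →L[ℂ] H)) (η : H) (a : A) :
    π a η ∈ cyclicSubspace π η :=
  Submodule.le_topologicalClosure _ ⟨a, trivial, rfl⟩

lemma isClosed_cyclicSubspace (π : A →⋆ₙₐ[ℂ] (H →L[ℂ] H)) (η : H) :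
    IsClosed (cyclicSubspace π η : Set H) :=
  Submodule.isClosed_topologicalClosure _

instance (π : A →⋆ₙₐ[ℂ] (H →L[ℂ] H)) (η : H) : CompleteSpace (cyclicSubspace π η) :=
  (isClosed_cyclicSubspace π η).completeSpace_coe

lemma apply_mem_cyclicSubspace_of_mem {η v : H} (hv : v ∈ cyclicSubspace π η) (a : A) :
    π a v ∈ cyclicSubspace π η :=
  cyclicSubspace_induction (p := fun v => π a v ∈ cyclicSubspace π η)
    ((isClosed_cyclicSubspace π η).preimage (π a).continuous)
    (fun b => by
      have := apply_mem_cyclicSubspace π η (a * b)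
      rwa [map_mul] at this) hv

lemma starProjection_cyclicSubspace_apply (η : H) (a : A) (v : H) :
    (cyclicSubspace π η).starProjection (π a v) = π a ((cyclicSubspace π η).starProjection v) := by
  refine Submodule.eq_starProjection_of_mem_of_inner_eq_zero
    (apply_mem_cyclicSubspace_of_mem (Submodule.starProjection_apply_mem _ _) a) fun w hw => ?_
  rw [← map_sub, ← ContinuousLinearMap.adjoint_inner_right, ← ContinuousLinearMap.star_eq_adjoint,
    ← map_star]
  exact Submodule.starProjection_inner_eq_zero _ _ (apply_mem_cyclicSubspace_of_mem hw _)

/-- A vector in the range of a minimal projection of the represented algebra gives rise to a pure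
functional. -/
lemma IsGNS.exists_isPureFunctional (h : IsGNS f Λ π ξ) {b : A}
    (hmin : ∀ x, ∃ c : ℂ, π b * π x * π b = c • π b) {η : H} (hη : π b η = η) (hη0 : η ≠ 0) :
    ∃ g, IsPureFunctional g ∧ IsPositiveFunctional (f - g) := by
  -- `q` lies in the commutant, so compressing `f` by it gives a functional below `f`.
  set q := (cyclicSubspace π η).starProjection with hq
  have hqπ : ∀ a v, q (π a v) = π a (q v) := starProjection_cyclicSubspace_apply η
  have hηmem : η ∈ cyclicSubspace π η := by
    have := apply_mem_cyclicSubspace π η b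
    rwa [hη] at this
  have hqη : q η = η := Submodule.starProjection_eq_self_iff.mpr hηmem
  have hinner : ∀ v, ⟪v, q v⟫_ℂ = (‖q v‖ ^ 2 : ℝ) := fun v => by
    have h1 : q (q v) = q v :=
      Submodule.starProjection_eq_self_iff.mpr (Submodule.starProjection_apply_mem _ _)
    rw [← h1, ← Submodule.inner_starProjection_left_eq_right, inner_self_eq_norm_sq_to_K]
    rw [h1]; norm_cast
  have hqpos : ∀ v, 0 ≤ ⟪v, q v⟫_ℂ := fun v => by
    rw [hinner]; exact Complex.zero_le_real.mpr (sq_nonneg _)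
  set g := vectorFunctional Λ ξ q with hgdef
  have hgpos : IsPositiveFunctional g := h.vectorFunctional_positive hqπ hqpos
  have hle : IsPositiveFunctional (f - g) := by
    nth_rewrite 1 [← h.vectorFunctional_one]
    rw [← vectorFunctional_sub]
    refine h.vectorFunctional_positive (fun a v => by simp [hqπ]) fun v => ?_
    have h2 : ‖q v‖ ≤ ‖v‖ := Submodule.norm_starProjection_apply_le _ _
    have : ⟪v, (ContinuousLinearMap.id ℂ H - q) v⟫_ℂ = ((‖v‖ ^ 2 - ‖q v‖ ^ 2 : ℝ) : ℂ) := by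
      rw [sub_apply, inner_sub_right, hinner, id_apply, inner_self_eq_norm_sq_to_K,
        Complex.ofReal_sub, Complex.ofReal_pow, Complex.ofReal_pow]
      rfl
    rw [this]
    exact Complex.zero_le_real.mpr (sub_nonneg.mpr (by gcongr))
  refine ⟨g, ⟨hgpos, fun h0 => hη0 ?_, fun k hk hkg => ?_⟩, hle⟩
  · rw [← hqη]
    have : ∀ v, q v = 0 := fun v => by
      refine h.denseRange.induction_on v (isClosed_eq (by fun_prop) (by fun_prop)) fun a => ?_
      have h1 := h.vectorFunctional_star_mul hqπ a a
      rw [← hgdef, h0, hinner, zero_apply] at h1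
      have h2 : ‖q (Λ a)‖ ^ 2 = 0 := by exact_mod_cast h1.symm
      simpa using h2
    exact this η
  · have hkf : IsPositiveFunctional (f - k) := by
      have := hle.add hkg
      rwa [sub_add_sub_cancel] at this
    obtain ⟨K, _, _, _, Λ', π', ξ', hk'⟩ := hk.exists_isGNS
    obtain ⟨S, hS, -, hSπ⟩ := h.exists_intertwiner hk' hkf
    have hSq : ∀ v, ‖S v‖ ≤ ‖q v‖ := fun v => by
      refine h.denseRange.induction_on v (isClosed_le (by fun_prop) (by fun_prop)) fun a => ?_
      rw [hS, ← sq_le_sq₀ (norm_nonneg _) (norm_nonneg _), hk'.norm_sq]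
      have h1 := (hkg a).1
      rw [sub_apply, Complex.sub_re, Complex.zero_re, sub_nonneg] at h1
      refine h1.trans (le_of_eq ?_)
      rw [hgdef, h.vectorFunctional_star_mul hqπ, hinner, Complex.ofReal_re]
    have hSqv : ∀ v, S (q v) = S v := fun v => by
      have h1 := hSq (q v - v)
      have h2 : q (q v) = q v :=
        Submodule.starProjection_eq_self_iff.mpr (Submodule.starProjection_apply_mem _ _)
      rw [map_sub, map_sub, h2, sub_self, norm_zero] at h1
      exact sub_eq_zero.mp (norm_le_zero_iff.mp h1)
    -- `V` represents `k` in the commutant and lives on the cyclic subspace; the aim is that it is a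
    -- multiple of `q`.
    let V : H →L[ℂ] H := (adjoint S).comp S
    have hVdef : ∀ v, V v = adjoint S (S v) := fun _ => rfl
    have hVπ : ∀ a v, V (π a v) = π a (V v) := fun a v => by
      rw [hVdef, hVdef, hSπ, adjoint_intertwines hSπ]
    have hVinner : ∀ v w, ⟪v, V w⟫_ℂ = ⟪S v, S w⟫_ℂ := fun v w => by
      rw [hVdef, ContinuousLinearMap.adjoint_inner_right]
    have hVmem : V η ∈ cyclicSubspace π η := by
      rw [← Submodule.starProjection_eq_self_iff]
      refine ext_inner_left ℂ fun v => ?_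
      rw [← Submodule.inner_starProjection_left_eq_right, hVinner, ← hq, hSqv, ← hVinner]
    -- `V` commutes with `π b`, so `V η` is fixed by `π b`; minimality sends the whole cyclic
    -- subspace under `π b` into the line through `η`.
    obtain ⟨α, hα⟩ : ∃ α : ℂ, V η = α • η := by
      have h1 : π b (V η) = V η := by rw [← hVπ, hη]
      have h2 : π b (V η) ∈ ℂ ∙ η := by
        refine cyclicSubspace_induction (p := fun v => π b v ∈ ℂ ∙ η)
          ((Submodule.closed_of_finiteDimensional _).preimage (π b).continuous)
          (fun a => ?_) hVmem
        obtain ⟨c, hc⟩ := hmin a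
        rw [Submodule.mem_span_singleton]
        refine ⟨c, ?_⟩
        have := congrArg (fun T : H →L[ℂ] H => T η) hc
        simp only [mul_apply_eq_comp, smul_apply, hη] at this
        exact this.symm
      rw [h1, Submodule.mem_span_singleton] at h2
      obtain ⟨α, hα⟩ := h2
      exact ⟨α, hα.symm⟩
    have hVq : ∀ v, V v = α • q v := fun v => by
      have h1 : ∀ w ∈ cyclicSubspace π η, V w = α • w := fun w hw =>
        cyclicSubspace_induction (p := fun w => V w = α • w)
          (isClosed_eq (by fun_prop) (by fun_prop)) (fun a => by rw [hVπ, hα, map_smul]) hw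
      rw [← h1 _ (Submodule.starProjection_apply_mem _ _), hVdef, hVdef, ← hq, hSqv]
    have hαη : α * (‖η‖ ^ 2 : ℝ) = (‖S η‖ ^ 2 : ℝ) := by
      have h1 := hVinner η η
      rw [hα, inner_smul_right, inner_self_eq_norm_sq_to_K, inner_self_eq_norm_sq_to_K] at h1
      exact_mod_cast h1
    have hη2 : 0 < ‖η‖ ^ 2 := by positivity
    set t : ℝ := ‖S η‖ ^ 2 / ‖η‖ ^ 2 with ht
    have hαt : α = t := by
      rw [ht, Complex.ofReal_div, eq_div_iff (by exact_mod_cast hη2.ne'), hαη]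
    have htmem : t ∈ Set.Icc (0 : ℝ) 1 := by
      refine ⟨by positivity, (div_le_one hη2).mpr ?_⟩
      have := hSq η
      rw [hqη] at this
      gcongr
    refine ⟨t, htmem, ?_⟩
    have hmul : ∀ a, k (star a * a) = (t : ℂ) * g (star a * a) := fun a => by
      rw [hgdef, h.vectorFunctional_star_mul hqπ, ← inner_smul_right, ← hαt, ← hVq, hVinner, hS,
        hk'.inner_apply]
    have hzero : IsPositiveFunctional (k - (t : ℂ) • g) := fun a => by
      rw [sub_apply, smul_apply, smul_eq_mul, hmul, sub_self]
    refine sub_eq_zero.mp (hzero.eq_zero_of_star_mul_self fun a => ?_)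
    rw [sub_apply, smul_apply, smul_eq_mul, hmul, sub_self]

end MinimalVector

/-- If no spectrum of a self-adjoint element contains an interval, nonzero positive functionals
dominate pure ones. -/
theorem NoSpectralInterval.dominatesPure {A : Type*} [NonUnitalCStarAlgebra A]
    (hA : NoSpectralInterval A) : DominatesPure A := fun f hf hf0 => by
  obtain ⟨H, _, _, _, Λ, π, ξ, h⟩ := hf.exists_isGNS
  -- Closedness makes the range a C⋆-algebra, a quotient of `A`. The minimal projection is found
  -- there, since `A` itself may have none acting nontrivially on `H`.
  have : IsClosed (NonUnitalStarAlgHom.range π : Set (H →L[ℂ] H)) := π.isClosed_range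
  let φ : A →⋆ₙₐ[ℂ] NonUnitalStarAlgHom.range π := NonUnitalStarAlgHom.rangeRestrict π
  have hD : NoSpectralInterval (NonUnitalStarAlgHom.range π) := by
    refine hA.of_surjective (φ := φ) ?_
    rintro ⟨_, ⟨a, rfl⟩⟩
    exact ⟨a, rfl⟩
  obtain ⟨a, ha⟩ : ∃ a, π a ≠ 0 := by
    by_contra! h0
    exact hf0 (ContinuousLinearMap.ext fun a => by simp [h.eq_inner, ← h.apply_vec, h0])
  obtain ⟨⟨_, ⟨b, rfl⟩⟩, hp, hp0, hmin⟩ := hD.exists_minimal (a := φ a) fun h0 =>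
    ha (congrArg Subtype.val h0)
  obtain ⟨ζ, hζ⟩ : ∃ ζ, π b ζ ≠ 0 := by
    by_contra! h0
    exact hp0 (Subtype.ext (ContinuousLinearMap.ext h0))
  refine h.exists_isPureFunctional (b := b) (fun x => ?_) (η := π b ζ) ?_ hζ
  · obtain ⟨c, hc⟩ := hmin (φ x)
    exact ⟨c, congrArg Subtype.val hc⟩
  · exact congrArg (fun T : H →L[ℂ] H => T ζ) (congrArg Subtype.val hp.isIdempotentElem)

theorem DominatesPure.noSpectralInterval {A : Type*} [NonUnitalCStarAlgebra A]
    (hA : DominatesPure A) : NoSpectralInterval A :=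
  fun _ ha _ _ hs hst => hA.not_Icc_subset ha hs hst

/-- The property that nonzero positive functionals dominate pure ones passes to subalgebras. -/
theorem DominatesPure.of_injective {A B : Type*} [NonUnitalCStarAlgebra A]
    [NonUnitalCStarAlgebra B] (hB : DominatesPure B) {φ : A →⋆ₙₐ[ℂ] B}
    (hφ : Function.Injective φ) : DominatesPure A :=
  (hB.noSpectralInterval.of_injective hφ).dominatesPure

/-! ### Closed ⋆-subalgebras of locally C⋆-algebras -/

section Restriction

open Topology

variable {A : Type*} [NonUnitalRing A] [StarRing A] [Module ℂ A]
    [IsScalarTower ℂ A A] [SMulCommClass ℂ A A] [StarModule ℂ A]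

omit [IsScalarTower ℂ A A] [SMulCommClass ℂ A A] [StarModule ℂ A] in
lemma IsCStarSeminorm.comp {B : Type*} [NonUnitalRing B] [StarRing B] [Module ℂ B]
    {p : Seminorm ℂ A} (hp : IsCStarSeminorm p) (φ : B →⋆ₙₐ[ℂ] A) :
    IsCStarSeminorm (p.comp ((φ : B →ₙₐ[ℂ] A) : B →ₗ[ℂ] A)) where
  mul_le a b := by
    have := hp.mul_le (φ a) (φ b)
    rwa [← map_mul] at this
  star_mul_self a := by
    have := hp.star_mul_self (φ a)
    rwa [← StarHomClass.map_star φ, ← map_mul] at this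

lemma WithSeminorms.image_comp {E F : Type*} [AddCommGroup E] [Module ℂ E] [TopologicalSpace E]
    [IsTopologicalAddGroup E] [AddCommGroup F] [Module ℂ F] [TopologicalSpace F]
    {Γ : Set (Seminorm ℂ F)} (hΓ : WithSeminorms (fun p : Γ => (p : Seminorm ℂ F)))
    {L : E →ₗ[ℂ] F} (hL : IsInducing L) :
    WithSeminorms (fun p : (fun p => p.comp L) '' Γ => (p : Seminorm ℂ E)) := by
  have h := hL.withSeminorms hΓ
  rw [SeminormFamily.withSeminorms_iff_nhds_eq_iInf] at h ⊢
  rw [h]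
  refine (Set.surjective_mapsTo_image_restrict _ Γ).iInf_congr _ fun _ => rfl

lemma DirectedOn.image_comp {E F : Type*} [AddCommGroup E] [Module ℂ E] [AddCommGroup F]
    [Module ℂ F] {Γ : Set (Seminorm ℂ F)} (hΓ : DirectedOn (· ≤ ·) Γ) (L : E →ₗ[ℂ] F) :
    DirectedOn (· ≤ ·) ((fun p => p.comp L) '' Γ) := by
  rintro _ ⟨p, hp, rfl⟩ _ ⟨q, hq, rfl⟩
  obtain ⟨r, hr, h1, h2⟩ := hΓ p hp q hq
  exact ⟨_, ⟨r, hr, rfl⟩, Seminorm.comp_mono L h1, Seminorm.comp_mono L h2⟩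

variable [UniformSpace A] (B : NonUnitalStarSubalgebra ℂ A)

/-- Closed ⋆-subalgebras of locally C⋆-algebras are locally C⋆-algebras. -/
theorem IsLocallyCStarAlgebra.restrict (hA : IsLocallyCStarAlgebra A)
    (hB : IsClosed (B : Set A)) : IsLocallyCStarAlgebra B := by
  have := hA.isUniformAddGroup
  have := hA.continuousSMul
  have := hA.continuousMul
  have := hA.continuousStar
  have := hA.t2Space
  have := hA.completeSpace
  have hG : IsUniformAddGroup B :=
    IsUniformAddGroup.comap (NonUnitalStarSubalgebraClass.subtype B)
  refine ⟨hG, ⟨?_⟩, ⟨?_⟩, ⟨?_⟩, inferInstance, hB.completeSpace_coe, ?_⟩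
  · exact Continuous.subtype_mk (by fun_prop) _
  · exact Continuous.subtype_mk (by fun_prop) _
  · exact Continuous.subtype_mk (by fun_prop) _
  obtain ⟨Γ, hne, hdir, hcs, hΓ⟩ := hA.exists_seminorms
  let φ := NonUnitalStarSubalgebraClass.subtype B
  let L : B →ₗ[ℂ] A := ((φ : B →ₙₐ[ℂ] A) : B →ₗ[ℂ] A)
  have hL : IsInducing L := IsInducing.subtypeVal
  refine ⟨(fun p => p.comp L) '' Γ, hne.image _, hdir.image_comp L, ?_, hΓ.image_comp hL⟩
  rintro _ ⟨p, hp, rfl⟩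
  exact (hcs p hp).comp φ

/-- Closed ⋆-subalgebras of scattered locally C⋆-algebras are scattered. -/
theorem IsScattered.restrict (hA : IsLocallyCStarAlgebra A) (hs : IsScattered A)
    (hB : IsClosed (B : Set A)) : IsScattered B := by
  intro f hf
  have hBl := hA.restrict B hB
  have := hA.isUniformAddGroup
  obtain ⟨Γ, hne, hdir, hcs, hΓ⟩ := hA.exists_seminorms
  let φ := NonUnitalStarSubalgebraClass.subtype B
  obtain ⟨p, hp, C, hC⟩ : ∃ p ∈ Γ, ∃ C : ℝ, ∀ b : B, ‖f b‖ ≤ C * p b := by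
    have := hBl.isUniformAddGroup
    let L : B →ₗ[ℂ] A := ((φ : B →ₙₐ[ℂ] A) : B →ₗ[ℂ] A)
    have hL : IsInducing L := IsInducing.subtypeVal
    obtain ⟨_, ⟨p, hp, rfl⟩, h⟩ :=
      (hΓ.image_comp hL).exists_norm_le (hne.image _) (hdir.image_comp L) f
    exact ⟨p, hp, h⟩
  have : Fact (IsCStarSeminorm p) := ⟨hcs p hp⟩
  have hj := WithSeminorm.continuous_toCompletion (hΓ.continuous_seminorm ⟨p, hp⟩)
  have hAp : DominatesPure (WithSeminorm.Compl p) :=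
    IsScattered.dominatesPure hj (WithSeminorm.denseRange_toCompletion p) hA.exists_norm_sq_le hs
  let ψ : B →⋆ₙₐ[ℂ] WithSeminorm.Compl p := (WithSeminorm.toCompletion p).comp φ
  -- `E` is a C⋆-subalgebra of the completion of `A`, so it inherits domination; `f` is bounded by
  -- `p` and therefore extends to it.
  let E := (NonUnitalStarAlgHom.range ψ).topologicalClosure
  have : IsClosed (E : Set (WithSeminorm.Compl p)) :=
    NonUnitalStarSubalgebra.isClosed_topologicalClosure _
  have hE : IsScattered E := (hAp.of_injective (φ := NonUnitalStarSubalgebraClass.subtype E)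
    Subtype.val_injective).isScattered
  let k : B →⋆ₙₐ[ℂ] E := NonUnitalStarAlgHom.codRestrict ψ E fun b =>
    NonUnitalStarSubalgebra.le_topologicalClosure _ ⟨b, rfl⟩
  have hk : Continuous k := (hj.comp continuous_subtype_val).subtype_mk _
  have hkd : DenseRange k := by
    intro y
    rw [closure_subtype]
    have h : Subtype.val '' Set.range k = Set.range ψ := by
      rw [← Set.range_comp]; rfl
    rw [h]
    exact y.2
  obtain ⟨f', rfl⟩ := exists_comp_eq hk hkd (g := f) (C := C) fun b =>
    (hC b).trans_eq (congrArg (C * ·) (WithSeminorm.norm_toCompletion p (b : A)).symm)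
  obtain ⟨ι, hι, F, hF, hsum⟩ := hE f' (hf.of_comp hk hkd)
  exact ⟨ι, hι, fun i => (F i).comp (k.toCLM hk),
    fun i => (hF i).comp hk hkd hBl.exists_norm_sq_le, fun b => hsum (k b)⟩

end Restriction

theorem mainTheorem11 {A : Type*} [NonUnitalRing A] [StarRing A] [Module ℂ A]
    [IsScalarTower ℂ A A] [SMulCommClass ℂ A A] [StarModule ℂ A] [UniformSpace A]
    (hA : IsLocallyCStarAlgebra A) (hs : IsScattered A)
    (B : NonUnitalStarSubalgebra ℂ A) (hB : IsClosed (B : Set A)) :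
    IsLocallyCStarAlgebra B ∧ IsScattered B :=
  ⟨hA.restrict B hB, hs.restrict B hA hB⟩
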